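/- Let $q$ be an odd prime power, and let $V(4,q^2)$ carry the non-degenerate Hermitian form $h(x,y)=x_0y_3^q-x_1y_1^q-x_2y_2^q+x_3y_0^q$. Let $H(3,q^2)$ be its polar geometry, whose points and lines are the totally isotropic points and lines of $\mathrm{PG}(3,q^2)$. For distinct points $P=\langle p\rangle$, $Q=\langle q'\rangle$, $R=\langle r\rangle$ of $H(3,q^2)$ put $z(P,Q,R)=h(p,q')\,h(q',r)\,h(r,p)\,\mathrm{GF}(q)^*$, and let $e=\mathrm{GF}(q)^*$ be the identity of $\mathrm{GF}(q^2)^*/\mathrm{GF}(q)^*$. Let $\widehat V=\{(x,x^q,y,y^q,z,z^q):x,y,z\in\mathrm{GF}(q^2)\}$, a $6$-dimensional vector space over $\mathrm{GF}(q)$, and let $Q^-(5,q)$ be the elliptic quadric of $\mathrm{PG}(\widehat V)$ defined by the restriction to $\widehat V$ of $-X_1X_6-X_2X_5+X_3X_4$, that is, by $-xz^q-x^qz+y^{q+1}$; let $\perp$ be the associated orthogonality in $\widehat V$. Let $\kappa$ be the Klein correspondence, which sends the line $\langle x,y\rangle$ of $\mathrm{PG}(3,q^2)$ to the point $\langle(p_{01},p_{02},p_{03},p_{12},p_{13},p_{23})\rangle$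 with $p_{ij}=x_iy_j-x_jy_i$. Fix $\mu\in\mathrm{GF}(q^2)$ with $\mu^{q+1}=-1$, let $\tau(X_1,\dots,X_6)=(X_1,-\mu^qX_2,X_3,-\mu^qX_4,X_5,\mu^qX_6)$, and put $\rho=\tau\circ\kappa$. Then $\rho$ maps the lines of $H(3,q^2)$ to the points of $Q^-(5,q)$. For a point $P$ of $H(3,q^2)$ let $\rho(P)$ be the totally singular line of $Q^-(5,q)$ formed by the points $\rho(g)$, where $g$ runs over the totally isotropic lines on $P$. Three lines $l_1,l_2,l_3$ of $Q^-(5,q)$ are *in perspective* if they are mutually skew and, with $T_i=l_i^\perp$ and $s_k=T_i\cap T_j$ for $\{i,j,k\}=\{1,2,3\}$, the three subspaces $\langle l_i,s_i\rangle$, $i=1,2,3$, share a line. **Proposition.** Let $P$, $Q$, $R$ be three distinct points of $H(3,q^2)$ that do not all lie on a common hyperbolic line, that is, on a line $\langle x,y\rangle$ of $\mathrm{PG}(3,q^2)$ with $h(x,x)=h(y,y)=0$ and $h(x,y)=1$. Then $z(P,Q,R)=e$ if and only if the lines $\rho(P)$, $\rho(Q)$, $\rho(R)$ of $Q^-(5,q)$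 are in perspective. -/

import Mathlib

/-! Throughout, `F` is the finite field with `q = Fintype.card F` elements and `K` is its quadratic
extension (the theorem assumes `Module.finrank F K = 2`).  The points of the projective space of a
vector space are elements of `Projectivization`; its other subspaces are `Submodule`s, so a
projective line is a submodule of rank two and a solid is a submodule of rank four. -/

namespace HermitianKlein

section Hermitian

set_option linter.unusedSectionVars false

variable (F : Type*) {K : Type*} [Field F] [Fintype F] [Field K] [Algebra F K]

/-- The map `x ↦ x ^ q`. -/
def conj (x : K) : K := x ^ Fintype.card F

theorem conj_mul (x y : K) : conj F (x * y) = conj F x * conj F y := mul_pow x y _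

theorem conj_add (x y : K) : conj F (x + y) = conj F x + conj F y :=
  map_add (FiniteField.frobeniusAlgHom F K) x y

theorem conj_zero : conj F (0 : K) = 0 := map_zero (FiniteField.frobeniusAlgHom F K)

theorem conj_algebraMap_mul (c : F) (x : K) :
    conj F (algebraMap F K c * x) = algebraMap F K c * conj F x := by
  rw [conj_mul, conj, ← map_pow, FiniteField.pow_card]

/-- The Hermitian form `h(x, y) = x₀ y₃^q - x₁ y₁^q - x₂ y₂^q + x₃ y₀^q`. -/
def herm (x y : Fin 4 → K) : K :=
  x 0 * conj F (y 3) - x 1 * conj F (y 1) - x 2 * conj F (y 2) + x 3 * conj F (y 0)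

/-- `P` is a point of the Hermitian surface `H(3, q^2)` defined by `herm`. -/
def IsHermitianPoint (P : Projectivization K (Fin 4 → K)) : Prop :=
  herm F P.rep P.rep = 0

/-- `r` is a totally isotropic line, that is, a line of `H(3, q^2)`. -/
def IsHermitianLine (r : Submodule K (Fin 4 → K)) : Prop :=
  Module.finrank K r = 2 ∧ ∀ x ∈ r, ∀ y ∈ r, herm F x y = 0

/-- `r` is a hyperbolic line, that is, a line spanned by a hyperbolic pair of vectors. -/
def IsHyperbolicLine (r : Submodule K (Fin 4 → K)) : Prop :=
  ∃ x y : Fin 4 → K, herm F x x = 0 ∧ herm F y y = 0 ∧ herm F x y = 1 ∧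
    r = Submodule.span K {x, y}

/-- The orbit `a GF(q)^*` of `a : K`.  It is a coset of `GF(q)^*` in `K^*` when `a ≠ 0`, and it is
`{0}` when `a = 0`. -/
def cosetOf (a : K) : Set K := {b | ∃ c : F, c ≠ 0 ∧ b = a * algebraMap F K c}

/-- Shult's function `z(P, Q, R) = h(p, q) h(q, r) h(r, p) GF(q)^*`, where `p`, `q`, `r` span the
points `P`, `Q`, `R`. -/
noncomputable def shultZ (P Q R : Projectivization K (Fin 4 → K)) : Set K :=
  cosetOf F (herm F P.rep Q.rep * herm F Q.rep R.rep * herm F R.rep P.rep)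

variable (K) in
/-- The identity element `e = GF(q)^*` of `K^* / GF(q)^*`. -/
def shultE : Set K := cosetOf F (1 : K)

end Hermitian

section Klein

variable {F K : Type*} [Field F] [Fintype F] [Field K] [Algebra F K]

/-- The Plücker coordinates `(p₀₁, p₀₂, p₀₃, p₁₂, p₁₃, p₂₃)` of a pair of vectors, where
`pᵢⱼ = xᵢ yⱼ - xⱼ yᵢ`. -/
def pluecker (x y : Fin 4 → K) : Fin 6 → K :=
  ![x 0 * y 1 - x 1 * y 0, x 0 * y 2 - x 2 * y 0, x 0 * y 3 - x 3 * y 0,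
    x 1 * y 2 - x 2 * y 1, x 1 * y 3 - x 3 * y 1, x 2 * y 3 - x 3 * y 2]

/-- The Klein correspondence `κ`: the line `r` of `PG(3, q^2)` goes to the point of `PG(5, q^2)`
(a one-dimensional subspace) spanned by the Plücker coordinates of a basis of `r`; other pairs of
vectors of `r` give multiples of the same vector. -/
def klein (r : Submodule K (Fin 4 → K)) : Submodule K (Fin 6 → K) :=
  Submodule.span K {v | ∃ x ∈ r, ∃ y ∈ r, v = pluecker x y}

variable (F) in
/-- The coordinate change
`τ(X₁, …, X₆) = (X₁, -μ^q X₂, X₃, -μ^q X₄, X₅, μ^q X₆)`. -/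
def tau (μ : K) : (Fin 6 → K) →ₗ[K] (Fin 6 → K) where
  toFun X := ![X 0, -(conj F μ) * X 1, X 2, -(conj F μ) * X 3, X 4, conj F μ * X 5]
  map_add' X Y := by
    ext i; fin_cases i <;> simp <;> ring
  map_smul' c X := by
    ext i; fin_cases i <;> simp <;> ring

variable (F) in
/-- `ρ = τ ∘ κ` on lines of `PG(3, q^2)`. -/
def rhoLine (μ : K) (r : Submodule K (Fin 4 → K)) : Submodule K (Fin 6 → K) :=
  (klein r).map (tau F μ)

variable (F K) in
/-- The six-dimensional `GF(q)`-space `V̂` of all vectors `(x, x^q, y, y^q, z, z^q)`. -/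
def Vhat : Submodule F (Fin 6 → K) where
  carrier := {v | v 1 = conj F (v 0) ∧ v 3 = conj F (v 2) ∧ v 5 = conj F (v 4)}
  add_mem' := by
    rintro v w ⟨h1, h2, h3⟩ ⟨k1, k2, k3⟩
    exact ⟨by simp only [Pi.add_apply, conj_add, h1, k1],
      by simp only [Pi.add_apply, conj_add, h2, k2],
      by simp only [Pi.add_apply, conj_add, h3, k3]⟩
  zero_mem' := ⟨(conj_zero F).symm, (conj_zero F).symm, (conj_zero F).symm⟩
  smul_mem' := by
    rintro c v ⟨h1, h2, h3⟩
    exact ⟨by simp only [Pi.smul_apply, Algebra.smul_def, conj_algebraMap_mul, h1],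
      by simp only [Pi.smul_apply, Algebra.smul_def, conj_algebraMap_mul, h2],
      by simp only [Pi.smul_apply, Algebra.smul_def, conj_algebraMap_mul, h3]⟩

/-- The quadratic form `-X₁X₆ - X₂X₅ + X₃X₄`.  Its restriction to `Vhat F K` takes the value
`-x z^q - x^q z + y^(q+1)` at `(x, x^q, y, y^q, z, z^q)` and defines the elliptic quadric
`Q⁻(5, q)`. -/
def quadQ (X : Fin 6 → K) : K := -(X 0 * X 5) - X 1 * X 4 + X 2 * X 3

/-- The subspace `W^⊥` of `V̂`, with respect to the symmetric bilinear form
`Q(v + w) - Q(v) - Q(w)` associated with the quadratic form. -/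
def perp (W : Submodule F (Vhat F K)) : Submodule F (Vhat F K) where
  carrier := {v | ∀ w ∈ W, QuadraticMap.polar quadQ (v : Fin 6 → K) (w : Fin 6 → K) = 0}
  add_mem' := by
    intro a b ha hb w hw
    have h1 := ha w hw
    have h2 := hb w hw
    simp only [QuadraticMap.polar, quadQ, Pi.add_apply, Submodule.coe_add] at h1 h2 ⊢
    linear_combination h1 + h2
  zero_mem' := by
    intro w _
    simp [QuadraticMap.polar, quadQ]
  smul_mem' := by
    intro c a ha w hw
    have h1 := ha w hw
    have h2 : ∀ i, ((c • a : Vhat F K) : Fin 6 → K) i = algebraMap F K c * (a : Fin 6 → K) i :=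
      fun i => Algebra.smul_def c _
    simp only [QuadraticMap.polar, quadQ, Pi.add_apply, h2] at h1 ⊢
    linear_combination (algebraMap F K c) * h1

variable (F) in
/-- For a point `P` of `H(3, q^2)`, the line `ρ(P)` of `Q⁻(5, q)` whose points are the images
`ρ(r)` of the totally isotropic lines `r` on `P`.  It is given as the subspace of `V̂` spanned by
the vectors of `V̂` that lie in some `ρ(r)`. -/
def rhoPoint (μ : K) (P : Projectivization K (Fin 4 → K)) : Submodule F (Vhat F K) :=
  Submodule.span F {v | ∃ r : Submodule K (Fin 4 → K),
    IsHermitianLine F r ∧ P.submodule ≤ r ∧ (v : Fin 6 → K) ∈ rhoLine F μ r}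

end Klein

section Perspective

/-- Three mutually skew lines `l i` and three solids `T i`, with `T i` containing `l i` and skew to
the other two lines, are in perspective: writing `s k = T i ∩ T j` for `{i, j, k} = {0, 1, 2}`, the
three subspaces `⟨l i, s i⟩` share a line. -/
structure InPerspectiveWith {F U : Type*} [Field F] [AddCommGroup U] [Module F U]
    (l T : Fin 3 → Submodule F U) : Prop where
  finrank_line : ∀ i, Module.finrank F (l i) = 2
  line_skew : ∀ i j, i ≠ j → Disjoint (l i) (l j)
  finrank_solid : ∀ i, Module.finrank F (T i) = 4
  line_le_solid : ∀ i, l i ≤ T i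
  solid_skew : ∀ i j, i ≠ j → Disjoint (T i) (l j)
  share_line : ∃ L : Submodule F U, Module.finrank F L = 2 ∧
    L ≤ l 0 ⊔ (T 1 ⊓ T 2) ∧ L ≤ l 1 ⊔ (T 0 ⊓ T 2) ∧ L ≤ l 2 ⊔ (T 0 ⊓ T 1)

/-- Three lines of `Q⁻(5, q)` are in perspective: the solids are taken to be `T i = (l i)^⊥`. -/
def InPerspective {F K : Type*} [Field F] [Fintype F] [Field K] [Algebra F K]
    (l m n : Submodule F (Vhat F K)) : Prop :=
  InPerspectiveWith ![l, m, n] ![perp l, perp m, perp n]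

end Perspective

end HermitianKlein

/-! Write `x̄` for `x^q`. The Klein map turns unitary maps of determinant one into isometries of
`V̂`. Indeed, on vectors `τ(κ(x, y))` the polar form `B` is, up to a constant, the determinant of
four vectors, and `B(X*, Y)` is, up to sign, a 2×2 Hermitian Gram determinant, where `*` is the
semilinear involution with fixed space `V̂` (`polarForm_tauPluecker`,
`polarForm_star6_tauPluecker`). A unitary map of determinant one preserves both, so its exterior
square commutes with `*` and acts on `V̂`, carrying each line `ρ(P)` to the line of the image point.

If two of the points are orthogonal, both sides fail: the product defining `z` is zero, and the two
lines meet in the image of the totally isotropic line on the two points (`not_disjoint_lineOf`).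
Otherwise scale to `h(p, q) = h(r, q) = 1`. This multiplies the product by norms, so `z = e` says
that `a = h(r, p)` lies in `F`. By `exists_isFrame` one may take `p = e₀`, `q = e₃`, `r = (1, b, c,
a)`, with `a + ā = b b̄ + c c̄`; the hypothesis on hyperbolic lines gives `(b, c) ≠ (0, 0)`.

In the coordinates `(X, Y, Z)` of `V̂`, put `w(Y) = bY + μ c̄ Ȳ` and `φ(X) = (b b̄ - a)X + μ b c̄
X̄`. The three spans `⟨lᵢ, sᵢ⟩` are given by `Z = w(Y)`, by `(b b̄ - a)X̄ + μ̄ b̄ c X = conj w(Y)`,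
and by `Z = φ(X)`. Together they force `(ā - a)X̄ = 0`. If `a ∉ F`, then `X = Z = 0` and `w(Y) = 0`,
which leaves less than a line because `w ≠ 0`. If `a ∈ F`, the second equation follows from the
other two, and `φ` is invertible with determinant `a ā`, so the solutions form a graph over `Y`,
which is a line (`inPerspective_normalForm_iff`). -/

namespace HermitianKlein

set_option linter.unusedSectionVars false

/-! ### Conjugation of `K` over `F` -/

section ConjLemmas

variable {F K : Type*} [Field F] [Fintype F] [Field K] [Algebra F K]

theorem conj_neg (x : K) : conj F (-x) = -conj F x :=
  map_neg (FiniteField.frobeniusAlgHom F K) x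

theorem conj_sub (x y : K) : conj F (x - y) = conj F x - conj F y :=
  map_sub (FiniteField.frobeniusAlgHom F K) x y

theorem conj_one : conj F (1 : K) = 1 := map_one (FiniteField.frobeniusAlgHom F K)

theorem conj_inv (x : K) : conj F x⁻¹ = (conj F x)⁻¹ := inv_pow x _

theorem conj_div (x y : K) : conj F (x / y) = conj F x / conj F y := div_pow x y _

theorem conj_algebraMap (c : F) : conj F (algebraMap F K c) = algebraMap F K c := by
  rw [conj, ← map_pow, FiniteField.pow_card]

theorem conj_eq_zero {x : K} : conj F x = 0 ↔ x = 0 :=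
  pow_eq_zero_iff Fintype.card_ne_zero

/-- The polynomial `X^q - X` already splits over `F`, so passing to `K` adds no roots. -/
theorem exists_algebraMap_eq {x : K} (hx : conj F x = x) : ∃ c : F, algebraMap F K c = x := by
  classical
  have hroots := FiniteField.roots_X_pow_card_sub_X F
  have hsplit : (Polynomial.X ^ Fintype.card F - Polynomial.X : Polynomial F).Splits :=
    Polynomial.splits_iff_card_roots.2 <| by
      rw [hroots, FiniteField.X_pow_card_sub_X_natDegree_eq F Fintype.one_lt_card]; rfl
  have h2 := hsplit.roots_map (algebraMap F K)
  have hne : (Polynomial.X ^ Fintype.card F - Polynomial.X : Polynomial F) ≠ 0 :=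
    FiniteField.X_pow_card_sub_X_ne_zero F Fintype.one_lt_card
  have hmem : x ∈ ((Polynomial.X ^ Fintype.card F - Polynomial.X : Polynomial F).map
      (algebraMap F K)).roots := by
    rw [Polynomial.mem_roots (Polynomial.map_ne_zero hne)]
    simp only [Polynomial.map_sub, Polynomial.map_pow, Polynomial.map_X, Polynomial.IsRoot.def,
      Polynomial.eval_sub, Polynomial.eval_pow, Polynomial.eval_X]
    exact sub_eq_zero.2 hx
  rw [h2, hroots] at hmem
  obtain ⟨c, -, hc⟩ := Multiset.mem_map.1 hmem
  exact ⟨c, hc⟩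

theorem conj_conj (hdeg : Module.finrank F K = 2) (x : K) : conj F (conj F x) = x := by
  have : Module.Finite F K := Module.finite_of_finrank_pos (by omega)
  have : Finite K := Module.finite_of_finite F
  have := Fintype.ofFinite K
  have hcard : Fintype.card K = Fintype.card F ^ 2 := by
    rw [Module.card_eq_pow_finrank (K := F), hdeg]
  rw [conj, conj, ← pow_mul, ← sq, ← hcard, FiniteField.pow_card]

theorem exists_conj_ne (hdeg : Module.finrank F K = 2) : ∃ x : K, conj F x ≠ x := by
  by_contra! h
  have hsurj : Function.Surjective (Algebra.linearMap F K) := fun x => exists_algebraMap_eq (h x)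
  have hle := LinearMap.finrank_range_le (Algebra.linearMap F K)
  rw [LinearMap.range_eq_top.2 hsurj, finrank_top, hdeg, Module.finrank_self] at hle
  omega

theorem exists_mul_conj_eq (hdeg : Module.finrank F K = 2) (c : F) :
    ∃ t : K, t * conj F t = algebraMap F K c := by
  have : Module.Finite F K := Module.finite_of_finrank_pos (by omega)
  have : Finite K := Module.finite_of_finite F
  obtain ⟨t, ht⟩ := FiniteField.norm_surjective F K c
  refine ⟨t, ?_⟩
  rw [← ht, FiniteField.algebraMap_norm_eq_pow, Module.natCard_eq_pow_finrank (K := F), hdeg,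
    Nat.card_eq_fintype_card, conj, ← pow_succ']
  -- The norm is the power with exponent `(q² - 1)/(q - 1) = q + 1`.
  congr 1
  have h1 : 1 < Fintype.card F := Fintype.one_lt_card
  refine (Nat.div_eq_of_eq_mul_left (by omega) ?_).symm
  have := Nat.sq_sub_sq (Fintype.card F) 1
  simpa using this

theorem two_ne_zero_of_odd (hodd : Odd (Fintype.card F)) : (2 : K) ≠ 0 := by
  intro h
  have h2 : (2 : F) = 0 := by
    apply (algebraMap F K).injective
    rw [map_ofNat, map_zero, h]
  have : CharP F 2 := CharTwo.of_one_ne_zero_of_two_eq_zero one_ne_zero h2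
  have h3 : Fintype.card F % 2 = 0 := FiniteField.even_card_of_char_two (ringChar.eq F 2)
  rw [Nat.odd_iff] at hodd
  omega

/-- If `c x + c̄ x̄ = 0` for all `x`, then `c = 0`. -/
theorem eq_zero_of_trace_mul_eq_zero (hdeg : Module.finrank F K = 2) {c : K}
    (h : ∀ x : K, c * x + conj F c * conj F x = 0) : c = 0 := by
  obtain ⟨x, hx⟩ := exists_conj_ne (F := F) (K := K) hdeg
  have h1 := h 1
  rw [conj_one] at h1
  have h2 : c * (x - conj F x) = 0 := by linear_combination h x - conj F x * h1
  exact (mul_eq_zero.1 h2).resolve_right (sub_ne_zero.2 (Ne.symm hx))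

end ConjLemmas

/-! ### The Hermitian form -/

section HermLemmas

variable {F K : Type*} [Field F] [Fintype F] [Field K] [Algebra F K]

theorem herm_add_left (x y z : Fin 4 → K) : herm F (x + y) z = herm F x z + herm F y z := by
  simp only [herm, Pi.add_apply]; ring

theorem herm_smul_left (c : K) (x z : Fin 4 → K) : herm F (c • x) z = c * herm F x z := by
  simp only [herm, Pi.smul_apply, smul_eq_mul]; ring

theorem herm_add_right (x y z : Fin 4 → K) : herm F x (y + z) = herm F x y + herm F x z := by
  simp only [herm, Pi.add_apply, conj_add]; ring

theorem herm_smul_right (c : K) (x z : Fin 4 → K) :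
    herm F x (c • z) = conj F c * herm F x z := by
  simp only [herm, Pi.smul_apply, smul_eq_mul, conj_mul]; ring

theorem herm_sub_left (x y z : Fin 4 → K) : herm F (x - y) z = herm F x z - herm F y z := by
  simp only [herm, Pi.sub_apply]; ring

theorem herm_sub_right (x y z : Fin 4 → K) : herm F x (y - z) = herm F x y - herm F x z := by
  simp only [herm, Pi.sub_apply, conj_sub]; ring

theorem conj_herm (hdeg : Module.finrank F K = 2) (x y : Fin 4 → K) :
    conj F (herm F x y) = herm F y x := by
  simp only [herm, conj_add, conj_sub, conj_mul, conj_conj hdeg]; ring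

theorem herm_comm_zero (hdeg : Module.finrank F K = 2) {x y : Fin 4 → K} (h : herm F x y = 0) :
    herm F y x = 0 := by
  rw [← conj_herm hdeg, h, conj_zero]

variable (F) in
/-- The functional `x ↦ h(x, y)`. -/
def hermLeft (y : Fin 4 → K) : (Fin 4 → K) →ₗ[K] K where
  toFun x := herm F x y
  map_add' x z := herm_add_left x z y
  map_smul' c x := herm_smul_left c x y

@[simp] theorem hermLeft_apply (x y : Fin 4 → K) : hermLeft F y x = herm F x y := rfl

theorem eq_zero_of_herm_eq_zero {y : Fin 4 → K} (h : ∀ x, herm F x y = 0) : y = 0 := by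
  have h0 := h (Pi.single 0 1)
  have h1 := h (Pi.single 1 1)
  have h2 := h (Pi.single 2 1)
  have h3 := h (Pi.single 3 1)
  simp [herm, conj_eq_zero] at h0 h1 h2 h3
  ext i
  fin_cases i <;> simp [*]

theorem exists_herm_eq_one {y : Fin 4 → K} (hy : y ≠ 0) : ∃ x, herm F x y = 1 := by
  by_contra! h
  refine hy (eq_zero_of_herm_eq_zero (F := F) fun x => ?_)
  by_contra hx
  refine h ((herm F x y)⁻¹ • x) ?_
  rw [herm_smul_left, inv_mul_cancel₀ hx]

/-- Three vectors always have a common nonzero orthogonal vector. -/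
theorem exists_ne_zero_orthogonal (a b c : Fin 4 → K) :
    ∃ x : Fin 4 → K, x ≠ 0 ∧ herm F x a = 0 ∧ herm F x b = 0 ∧ herm F x c = 0 := by
  let f : (Fin 4 → K) →ₗ[K] (Fin 3 → K) :=
    LinearMap.pi ![hermLeft F a, hermLeft F b, hermLeft F c]
  have hker : LinearMap.ker f ≠ ⊥ := LinearMap.ker_ne_bot_of_finrank_lt (by simp)
  obtain ⟨x, hx, hx0⟩ := Submodule.exists_mem_ne_zero_of_ne_bot hker
  have h : ∀ i, f x i = 0 := fun i => by rw [LinearMap.mem_ker.1 hx]; rfl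
  exact ⟨x, hx0, h 0, h 1, h 2⟩

end HermLemmas

/-! ### The Klein quadric and the involution fixing `V̂` -/

section PlueckerForms

variable {F K : Type*} [Field F] [Fintype F] [Field K] [Algebra F K]

variable (F) in
/-- The map `τ ∘ κ` on pairs of vectors. -/
def tauPluecker (μ : K) (x y : Fin 4 → K) : Fin 6 → K := tau F μ (pluecker x y)

theorem tauPluecker_eq (μ : K) (x y : Fin 4 → K) : tauPluecker F μ x y =
    ![x 0 * y 1 - x 1 * y 0, -(conj F μ) * (x 0 * y 2 - x 2 * y 0), x 0 * y 3 - x 3 * y 0,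
      -(conj F μ) * (x 1 * y 2 - x 2 * y 1), x 1 * y 3 - x 3 * y 1,
      conj F μ * (x 2 * y 3 - x 3 * y 2)] := rfl

/-- The polar form of `quadQ`. -/
def polarForm (X Y : Fin 6 → K) : K :=
  -(X 0 * Y 5) - X 5 * Y 0 - X 1 * Y 4 - X 4 * Y 1 + X 2 * Y 3 + X 3 * Y 2

theorem polar_quadQ (X Y : Fin 6 → K) : QuadraticMap.polar quadQ X Y = polarForm X Y := by
  simp only [QuadraticMap.polar, quadQ, polarForm, Pi.add_apply]; ring

theorem polarForm_comm (X Y : Fin 6 → K) : polarForm X Y = polarForm Y X := by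
  simp only [polarForm]; ring

theorem polarForm_add_left (X Y Z : Fin 6 → K) :
    polarForm (X + Y) Z = polarForm X Z + polarForm Y Z := by
  simp only [polarForm, Pi.add_apply]; ring

theorem polarForm_sub_left (X Y Z : Fin 6 → K) :
    polarForm (X - Y) Z = polarForm X Z - polarForm Y Z := by
  simp only [polarForm, Pi.sub_apply]; ring

theorem eq_zero_of_polarForm_eq_zero {X : Fin 6 → K} (h : ∀ Y, polarForm X Y = 0) : X = 0 := by
  ext i
  have h0 := h (Pi.single 0 1)
  have h1 := h (Pi.single 1 1)
  have h2 := h (Pi.single 2 1)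
  have h3 := h (Pi.single 3 1)
  have h4 := h (Pi.single 4 1)
  have h5 := h (Pi.single 5 1)
  simp [polarForm] at h0 h1 h2 h3 h4 h5
  fin_cases i <;> simp [*]

variable (F) in
/-- The semilinear involution of `K⁶` (when `F ⊆ K` is quadratic) whose fixed vectors form `V̂`. -/
def star6 (X : Fin 6 → K) : Fin 6 → K :=
  ![conj F (X 1), conj F (X 0), conj F (X 3), conj F (X 2), conj F (X 5), conj F (X 4)]

theorem star6_add (X Y : Fin 6 → K) : star6 F (X + Y) = star6 F X + star6 F Y := by
  ext i; fin_cases i <;> simp [star6, conj_add]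

theorem mem_Vhat_iff (hdeg : Module.finrank F K = 2) {X : Fin 6 → K} :
    X ∈ Vhat F K ↔ star6 F X = X := by
  constructor
  · rintro ⟨h1, h2, h3⟩
    ext i
    fin_cases i <;> simp [star6, h1, h2, h3, conj_conj hdeg]
  · intro h
    refine ⟨?_, ?_, ?_⟩
    · exact (congrFun h 1).symm
    · exact (congrFun h 3).symm
    · exact (congrFun h 5).symm

/-- This is the wedge pairing of `x ∧ y` with `u ∧ v`; `τ` only rescales it by a constant. -/
theorem polarForm_tauPluecker (μ : K) (x y u v : Fin 4 → K) :
    polarForm (tauPluecker F μ x y) (tauPluecker F μ u v) =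
      -(conj F μ) * Matrix.det (Matrix.of ![x, y, u, v]) := by
  simp [polarForm, tauPluecker_eq, Matrix.det_succ_row_zero, Fin.sum_univ_succ, Fin.succAbove]
  ring

/-- The norm condition on `μ` makes the involution correspond to the Hermitian form induced on the
exterior square. Hence `star6` is expressed through unitary invariants. -/
theorem polarForm_star6_tauPluecker (hdeg : Module.finrank F K = 2) {μ : K}
    (hμ : μ * conj F μ = -1) (x y u v : Fin 4 → K) :
    polarForm (star6 F (tauPluecker F μ x y)) (tauPluecker F μ u v) =
      -(herm F u x * herm F v y - herm F u y * herm F v x) := by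
  simp [polarForm, star6, tauPluecker_eq, herm, conj_mul, conj_sub, conj_neg, conj_conj hdeg]
  linear_combination ((conj F (x 1) * conj F (y 2) - conj F (x 2) * conj F (y 1)) *
      (u 1 * v 2 - u 2 * v 1)
    + (conj F (x 0) * conj F (y 2) - conj F (x 2) * conj F (y 0)) *
      (u 2 * v 3 - u 3 * v 2)
    + (conj F (x 2) * conj F (y 3) - conj F (x 3) * conj F (y 2)) *
      (u 0 * v 2 - u 2 * v 0)) * hμ

theorem tauPluecker_add_right (μ : K) (x y z : Fin 4 → K) :
    tauPluecker F μ x (y + z) = tauPluecker F μ x y + tauPluecker F μ x z := by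
  ext i; fin_cases i <;> simp [tauPluecker_eq] <;> ring

theorem tauPluecker_smul_right (μ c : K) (x y : Fin 4 → K) :
    tauPluecker F μ x (c • y) = c • tauPluecker F μ x y := by
  ext i; fin_cases i <;> simp [tauPluecker_eq] <;> ring

theorem tauPluecker_smul_left (μ c : K) (x y : Fin 4 → K) :
    tauPluecker F μ (c • x) y = c • tauPluecker F μ x y := by
  ext i; fin_cases i <;> simp [tauPluecker_eq] <;> ring

theorem tauPluecker_self (μ : K) (x : Fin 4 → K) : tauPluecker F μ x x = 0 := by
  ext i; fin_cases i <;> simp [tauPluecker_eq] <;> ring_nf <;> simp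

/-- Every vector of `K⁶` is a combination of vectors `τ(κ(x, y))`. -/
theorem tauPluecker_induction {μ : K} (hμ : μ * conj F μ = -1) {p : (Fin 6 → K) → Prop}
    (hadd : ∀ X Y, p X → p Y → p (X + Y)) (hpl : ∀ x y, p (tauPluecker F μ x y))
    (X : Fin 6 → K) : p X := by
  -- Plücker coordinates grouped by their smaller index: each group is decomposable. The factors `μ`
  -- and `-μ` undo those of `τ`.
  have key : X = tauPluecker F μ ![1, 0, 0, 0] ![0, X 0, μ * X 1, X 2] +
      (tauPluecker F μ ![0, 1, 0, 0] ![0, 0, μ * X 3, X 4] +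
        tauPluecker F μ ![0, 0, 1, 0] ![0, 0, 0, -μ * X 5]) := by
    ext i
    fin_cases i <;> simp [tauPluecker_eq]
    · linear_combination X 1 * hμ
    · linear_combination X 3 * hμ
    · linear_combination X 5 * hμ
  rw [key]
  exact hadd _ _ (hpl _ _) (hadd _ _ (hpl _ _) (hpl _ _))

end PlueckerForms

/-! ### Isometric frames and the isometries of `V̂` they induce -/

section Frames

variable {F K : Type*} [Field F] [Fintype F] [Field K] [Algebra F K]

/-- The linear map sending the standard basis to the frame `f`. -/
def frameMap (f : Fin 4 → Fin 4 → K) : (Fin 4 → K) →ₗ[K] (Fin 4 → K) :=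
  Matrix.vecMulLinear (Matrix.of f)

theorem frameMap_apply (f : Fin 4 → Fin 4 → K) (x : Fin 4 → K) (i : Fin 4) :
    frameMap f x i = x 0 * f 0 i + x 1 * f 1 i + x 2 * f 2 i + x 3 * f 3 i := by
  simp [frameMap, Matrix.vecMul, dotProduct, Fin.sum_univ_succ]; ring

theorem frameMap_eq (f : Fin 4 → Fin 4 → K) (x : Fin 4 → K) :
    frameMap f x = x 0 • f 0 + x 1 • f 1 + x 2 • f 2 + x 3 • f 3 := by
  ext i; simp [frameMap_apply]

variable (F) in
/-- The linear map of `K⁶` induced by the frame `f` through `τ ∘ κ`. -/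
def frameMap6 (μ : K) (f : Fin 4 → Fin 4 → K) : (Fin 6 → K) →ₗ[K] (Fin 6 → K) where
  toFun X := X 0 • tauPluecker F μ (f 0) (f 1) + (μ * X 1) • tauPluecker F μ (f 0) (f 2) +
    X 2 • tauPluecker F μ (f 0) (f 3) + (μ * X 3) • tauPluecker F μ (f 1) (f 2) +
    X 4 • tauPluecker F μ (f 1) (f 3) + (-μ * X 5) • tauPluecker F μ (f 2) (f 3)
  map_add' X Y := by
    ext i; simp only [Pi.add_apply, Pi.smul_apply, smul_eq_mul]; ring
  map_smul' c X := by
    ext i; simp only [Pi.add_apply, Pi.smul_apply, smul_eq_mul, RingHom.id_apply]; ring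

theorem frameMap6_tauPluecker {μ : K} (hμ : μ * conj F μ = -1) (f : Fin 4 → Fin 4 → K)
    (x y : Fin 4 → K) :
    frameMap6 F μ f (tauPluecker F μ x y) = tauPluecker F μ (frameMap f x) (frameMap f y) := by
  have h : frameMap6 F μ f (tauPluecker F μ x y) =
      (x 0 * y 1 - x 1 * y 0) • tauPluecker F μ (f 0) (f 1) +
      (x 0 * y 2 - x 2 * y 0) • tauPluecker F μ (f 0) (f 2) +
      (x 0 * y 3 - x 3 * y 0) • tauPluecker F μ (f 0) (f 3) +
      (x 1 * y 2 - x 2 * y 1) • tauPluecker F μ (f 1) (f 2) +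
      (x 1 * y 3 - x 3 * y 1) • tauPluecker F μ (f 1) (f 3) +
      (x 2 * y 3 - x 3 * y 2) • tauPluecker F μ (f 2) (f 3) := by
    have e : ∀ a : K, μ * (-(conj F μ) * a) = a := fun a => by linear_combination -a * hμ
    have e' : ∀ a : K, -μ * (conj F μ * a) = a := fun a => by linear_combination -a * hμ
    show (_ • _ + (μ * (-(conj F μ) * (x 0 * y 2 - x 2 * y 0))) • _ + _ • _ +
      (μ * (-(conj F μ) * (x 1 * y 2 - x 2 * y 1))) • _ + _ • _ +
      (-μ * (conj F μ * (x 2 * y 3 - x 3 * y 2))) • _ : Fin 6 → K) = _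
    rw [e, e, e']
    rfl
  rw [h]
  ext i
  fin_cases i <;> simp [tauPluecker_eq, frameMap_apply] <;> ring

/-- An isometric frame: the Gram matrix is that of the standard basis, and the determinant
is one. -/
structure IsFrame (F : Type*) {K : Type*} [Field F] [Fintype F] [Field K] [Algebra F K]
    (f : Fin 4 → Fin 4 → K) : Prop where
  herm_map : ∀ x y, herm F (frameMap f x) (frameMap f y) = herm F x y
  det_eq : (Matrix.of f).det = 1

variable {f : Fin 4 → Fin 4 → K}

theorem IsFrame.surjective (hf : IsFrame F f) : Function.Surjective (frameMap f) := by
  intro x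
  refine ⟨Matrix.vecMul x (Matrix.of f)⁻¹, ?_⟩
  rw [frameMap, Matrix.vecMulLinear_apply, Matrix.vecMul_vecMul,
    Matrix.nonsing_inv_mul _ (by rw [hf.det_eq]; exact isUnit_one), Matrix.vecMul_one]

theorem polarForm_frameMap6 {μ : K} (hμ : μ * conj F μ = -1) (hf : IsFrame F f)
    (X Y : Fin 6 → K) :
    polarForm (frameMap6 F μ f X) (frameMap6 F μ f Y) = polarForm X Y := by
  revert X
  refine tauPluecker_induction hμ (fun X X' h h' => ?_) fun x y => ?_
  · rw [map_add, polarForm_add_left, polarForm_add_left, h, h']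
  revert Y
  refine tauPluecker_induction hμ (fun Y Y' h h' => ?_) fun u v => ?_
  · rw [map_add, polarForm_comm, polarForm_add_left, polarForm_comm _ (Y + Y'),
      polarForm_add_left, polarForm_comm _ (frameMap6 F μ f _), h, polarForm_comm Y,
      polarForm_comm (frameMap6 F μ f Y'), h', polarForm_comm Y']
  rw [frameMap6_tauPluecker hμ, frameMap6_tauPluecker hμ, polarForm_tauPluecker,
    polarForm_tauPluecker]
  have hmul : Matrix.of ![frameMap f x, frameMap f y, frameMap f u, frameMap f v] =
      Matrix.of ![x, y, u, v] * Matrix.of f := by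
    ext i j
    fin_cases i <;> rfl
  rw [hmul, Matrix.det_mul, hf.det_eq, mul_one]

theorem polarForm_star6_frameMap6 (hdeg : Module.finrank F K = 2) {μ : K}
    (hμ : μ * conj F μ = -1) (hf : IsFrame F f) (X Y : Fin 6 → K) :
    polarForm (star6 F (frameMap6 F μ f X)) (frameMap6 F μ f Y) = polarForm (star6 F X) Y := by
  revert X
  refine tauPluecker_induction hμ (fun X X' h h' => ?_) fun x y => ?_
  · rw [map_add, star6_add, star6_add, polarForm_add_left, polarForm_add_left, h, h']
  revert Y
  refine tauPluecker_induction hμ (fun Y Y' h h' => ?_) fun u v => ?_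
  · rw [map_add, polarForm_comm, polarForm_add_left, polarForm_comm _ (Y + Y'),
      polarForm_add_left, polarForm_comm _ (star6 F (frameMap6 F μ f _)), h, polarForm_comm Y,
      polarForm_comm (frameMap6 F μ f Y'), h', polarForm_comm Y']
  rw [frameMap6_tauPluecker hμ, frameMap6_tauPluecker hμ, polarForm_star6_tauPluecker hdeg hμ,
    polarForm_star6_tauPluecker hdeg hμ]
  simp only [hf.herm_map]

theorem frameMap6_injective {μ : K} (hμ : μ * conj F μ = -1) (hf : IsFrame F f) :
    Function.Injective (frameMap6 F μ f) := by
  rw [injective_iff_map_eq_zero]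
  intro X hX
  refine eq_zero_of_polarForm_eq_zero fun Y => ?_
  rw [← polarForm_frameMap6 hμ hf, hX]
  simp [polarForm]

/-- Both `B(X, Y)` and `B(X*, Y)` are invariant, and `B` is non-degenerate, so `X*` is determined by
its pairings. -/
theorem star6_frameMap6 (hdeg : Module.finrank F K = 2) {μ : K}
    (hμ : μ * conj F μ = -1) (hf : IsFrame F f) (X : Fin 6 → K) :
    star6 F (frameMap6 F μ f X) = frameMap6 F μ f (star6 F X) := by
  rw [← sub_eq_zero]
  refine eq_zero_of_polarForm_eq_zero fun Y => ?_
  obtain ⟨Y, rfl⟩ := LinearMap.injective_iff_surjective.1 (frameMap6_injective hμ hf) Y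
  rw [polarForm_sub_left, polarForm_star6_frameMap6 hdeg hμ hf, polarForm_frameMap6 hμ hf,
    sub_self]

theorem frameMap6_mem_Vhat_iff (hdeg : Module.finrank F K = 2) {μ : K}
    (hμ : μ * conj F μ = -1) (hf : IsFrame F f) (X : Fin 6 → K) :
    frameMap6 F μ f X ∈ Vhat F K ↔ X ∈ Vhat F K := by
  rw [mem_Vhat_iff hdeg, mem_Vhat_iff hdeg, star6_frameMap6 hdeg hμ hf,
    (frameMap6_injective hμ hf).eq_iff]

/-- The isometry of `V̂` induced by an isometric frame. -/
theorem exists_vhatEquiv (hdeg : Module.finrank F K = 2) {μ : K}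
    (hμ : μ * conj F μ = -1) (hf : IsFrame F f) :
    ∃ e : Vhat F K ≃ₗ[F] Vhat F K, ∀ v, (e v : Fin 6 → K) = frameMap6 F μ f v := by
  let g : Vhat F K →ₗ[F] Vhat F K :=
    ((frameMap6 F μ f).restrictScalars F).restrict
      fun X hX => (frameMap6_mem_Vhat_iff hdeg hμ hf X).2 hX
  refine ⟨LinearEquiv.ofBijective g ⟨fun v w h => ?_, fun w => ?_⟩, fun v => rfl⟩
  · exact Subtype.ext (frameMap6_injective hμ hf (congrArg Subtype.val h))
  · obtain ⟨X, hX⟩ := LinearMap.injective_iff_surjective.1 (frameMap6_injective hμ hf) w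
    refine ⟨⟨X, (frameMap6_mem_Vhat_iff hdeg hμ hf X).1 (hX ▸ w.2)⟩, Subtype.ext hX⟩

/-- The hyperbolic pair is completed by an orthogonal basis `v, w` of its orthogonal complement with
`h(v, v) = h(w, w) = -1`. The determinant then has norm one, so rescaling `v` makes it equal to one.
-/
theorem exists_isFrame (hodd : Odd (Fintype.card F)) (hdeg : Module.finrank F K = 2)
    {p q : Fin 4 → K} (hp : herm F p p = 0) (hq : herm F q q = 0) (hpq : herm F p q = 1) :
    ∃ f : Fin 4 → Fin 4 → K, IsFrame F f ∧ f 0 = p ∧ f 3 = q := by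
  have h2 : (2 : K) ≠ 0 := two_ne_zero_of_odd hodd
  have hqp : herm F q p = 1 := by rw [← conj_herm hdeg, hpq, conj_one]
  have scale : ∀ v : Fin 4 → K, herm F v v ≠ 0 → ∃ c : K, herm F (c • v) (c • v) = -1 := by
    intro v hv
    obtain ⟨d, hd⟩ := exists_algebraMap_eq (conj_herm hdeg v v)
    obtain ⟨t, ht⟩ := exists_mul_conj_eq (K := K) hdeg (-d⁻¹)
    refine ⟨t, ?_⟩
    rw [herm_smul_left, herm_smul_right, ← hd, ← mul_assoc, ht, map_neg, map_inv₀, neg_mul,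
      inv_mul_cancel₀ (by rwa [hd])]
  have proj : ∀ u : Fin 4 → K, ∃ u', herm F u' p = 0 ∧ herm F u' q = 0 ∧
      ∀ v, herm F v p = 0 → herm F v q = 0 → herm F u' v = herm F u v := by
    intro u
    refine ⟨u - herm F u q • p - herm F u p • q, ?_, ?_, fun v hvp hvq => ?_⟩
    · simp [herm_sub_left, herm_smul_left, hp, hqp]
    · simp [herm_sub_left, herm_smul_left, hq, hpq]
    · simp [herm_sub_left, herm_smul_left, herm_comm_zero hdeg hvp, herm_comm_zero hdeg hvq]
  -- If every vector of the complement were isotropic, two of them with product one would have an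
  -- isotropic sum, giving `2 = 0`.
  have hv : ∃ v : Fin 4 → K, herm F v p = 0 ∧ herm F v q = 0 ∧ herm F v v ≠ 0 := by
    by_contra! hcon
    obtain ⟨v, hv0, hvp, hvq, -⟩ := exists_ne_zero_orthogonal (F := F) p q q
    obtain ⟨u, hu⟩ := exists_herm_eq_one (F := F) hv0
    obtain ⟨u', hup, huq, huv⟩ := proj u
    have h1 := hcon (u' + v) (by rw [herm_add_left, hup, hvp, add_zero])
      (by rw [herm_add_left, huq, hvq, add_zero])
    have h3 : herm F u' v = 1 := by rw [huv v hvp hvq, hu]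
    have h4 : herm F v u' = 1 := by rw [← conj_herm hdeg, h3, conj_one]
    rw [herm_add_left, herm_add_right, herm_add_right, hcon u' hup huq, hcon v hvp hvq, h3, h4]
      at h1
    exact h2 (by linear_combination h1)
  obtain ⟨v₀, hvp₀, hvq₀, hvv₀⟩ := hv
  obtain ⟨c, hvv⟩ := scale v₀ hvv₀
  have hvp : herm F (c • v₀) p = 0 := by rw [herm_smul_left, hvp₀, mul_zero]
  have hvq : herm F (c • v₀) q = 0 := by rw [herm_smul_left, hvq₀, mul_zero]
  generalize c • v₀ = v at hvv hvp hvq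
  obtain ⟨w₀, hw0, hwp₀, hwq₀, hwv₀⟩ := exists_ne_zero_orthogonal (F := F) p q v
  -- Otherwise `w₀` is orthogonal to the basis `p, q, v, w₀`, against non-degeneracy.
  have hww₀ : herm F w₀ w₀ ≠ 0 := by
    intro hww
    have hpv := herm_comm_zero hdeg hvp
    have hqv := herm_comm_zero hdeg hvq
    have hpw := herm_comm_zero hdeg hwp₀
    have hqw := herm_comm_zero hdeg hwq₀
    have hvw := herm_comm_zero hdeg hwv₀
    have hli : LinearIndependent K ![p, q, v, w₀] := by
      rw [Fintype.linearIndependent_iff]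
      intro g hg
      have hg' : g 0 • p + g 1 • q + g 2 • v + g 3 • w₀ = 0 := by
        simpa [Fin.sum_univ_succ, add_assoc] using hg
      have key : ∀ z, g 0 * herm F p z + g 1 * herm F q z + g 2 * herm F v z
          + g 3 * herm F w₀ z = 0 := by
        intro z
        rw [← herm_smul_left, ← herm_smul_left, ← herm_smul_left, ← herm_smul_left,
          ← herm_add_left, ← herm_add_left, ← herm_add_left, hg']
        simp [herm]
      have k0 : g 0 = 0 := by simpa [hpq, hq, hvq, hwq₀] using key q
      have k1 : g 1 = 0 := by simpa [hqp, hp, hvp, hwp₀] using key p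
      have k2 : g 2 = 0 := by simpa [hpv, hqv, hvv, hwv₀] using key v
      have k3 : g 3 = 0 := by simpa [k0, k1, k2, hw0] using hg'
      intro i
      fin_cases i <;> assumption
    let b := basisOfLinearIndependentOfCardEqFinrank hli (by simp)
    have hz : hermLeft F w₀ = 0 := by
      refine b.ext fun i => ?_
      fin_cases i <;> simp [b, hpw, hqw, hvw, hww]
    exact hw0 (eq_zero_of_herm_eq_zero (F := F) fun x => LinearMap.congr_fun hz x)
  obtain ⟨c', hww⟩ := scale w₀ hww₀
  have hwp : herm F (c' • w₀) p = 0 := by rw [herm_smul_left, hwp₀, mul_zero]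
  have hwq : herm F (c' • w₀) q = 0 := by rw [herm_smul_left, hwq₀, mul_zero]
  have hwv : herm F (c' • w₀) v = 0 := by rw [herm_smul_left, hwv₀, mul_zero]
  generalize c' • w₀ = w at hww hwp hwq hwv
  -- Kept general in `v`, since it is applied before and after the rescaling by `D⁻¹`.
  have gram : ∀ v : Fin 4 → K, herm F v p = 0 → herm F v q = 0 → herm F v v = -1 → herm F w v = 0 →
      ∀ x y, herm F (frameMap ![p, v, w, q] x) (frameMap ![p, v, w, q] y) = herm F x y := by
    intro v hvp hvq hvv hwv x y
    have hpv := herm_comm_zero hdeg hvp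
    have hqv := herm_comm_zero hdeg hvq
    have hpw := herm_comm_zero hdeg hwp
    have hqw := herm_comm_zero hdeg hwq
    have hvw := herm_comm_zero hdeg hwv
    rw [frameMap_eq, frameMap_eq]
    simp only [herm_add_left, herm_add_right, herm_smul_left, herm_smul_right]
    simp [hp, hq, hpq, hqp, hvp, hvq, hvv, hwv, hpv, hqv, hpw, hqw, hvw, hwp, hwq, hww]
    simp only [herm]
    ring
  have hdet : (Matrix.of ![p, v, w, q]).det * conj F (Matrix.of ![p, v, w, q]).det = 1 := by
    have hg := gram v hvp hvq hvv hwv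
    let J : Matrix (Fin 4) (Fin 4) K := !![0, 0, 0, 1; 0, -1, 0, 0; 0, 0, -1, 0; 1, 0, 0, 0]
    set M := Matrix.of ![p, v, w, q] with hM
    let φ : K →+* K := (FiniteField.frobeniusAlgHom F K : K →+* K)
    -- The frame is unitary for the Gram matrix `J` of `h`; taking determinants gives `D D̄ = 1`.
    have hMJ : M * J * (M.map φ).transpose = J := by
      have hh : ∀ i j, (M * J * (M.map φ).transpose) i j = herm F (M i) (M j) := by
        intro i j
        have : ∀ x, φ x = conj F x := fun x => rfl
        simp [Matrix.mul_apply, Fin.sum_univ_succ, J, herm, this]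
        ring
      have hrow : ∀ i, M i = frameMap ![p, v, w, q] (Pi.single i 1) := by
        intro i
        rw [frameMap, Matrix.vecMulLinear_apply, Matrix.single_one_vecMul]
        rfl
      ext i j
      rw [hh, hrow, hrow, hg]
      fin_cases i <;> fin_cases j <;> simp [herm, J, conj_zero, conj_one]
    have hJ : J.det ≠ 0 := by
      have : J.det = -1 := by
        simp [J, Matrix.det_succ_row_zero, Fin.sum_univ_succ, Fin.succAbove]
        norm_num
      rw [this]
      exact neg_ne_zero.2 one_ne_zero
    have hd := congrArg Matrix.det hMJ
    rw [Matrix.det_mul, Matrix.det_mul, Matrix.det_transpose, ← RingHom.mapMatrix_apply,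
      ← RingHom.map_det] at hd
    have hφ : φ M.det = conj F M.det := rfl
    rw [hφ] at hd
    have : (M.det * conj F M.det - 1) * J.det = 0 := by linear_combination hd
    exact sub_eq_zero.1 ((mul_eq_zero.1 this).resolve_right hJ)
  set D := (Matrix.of ![p, v, w, q]).det with hD
  have hD0 : D ≠ 0 := left_ne_zero_of_mul_eq_one hdet
  refine ⟨![p, D⁻¹ • v, w, q], ⟨?_, ?_⟩, rfl, rfl⟩
  · refine gram _ ?_ ?_ ?_ ?_
    · rw [herm_smul_left, hvp, mul_zero]
    · rw [herm_smul_left, hvq, mul_zero]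
    · rw [herm_smul_left, herm_smul_right, hvv, conj_inv, ← mul_assoc, ← mul_inv, hdet]
      simp
    · rw [herm_smul_right, hwv, mul_zero]
  · have hup : Matrix.of ![p, D⁻¹ • v, w, q] =
        (Matrix.of ![p, v, w, q]).updateRow 1 (D⁻¹ • v) := by
      ext i j
      fin_cases i <;> simp [Matrix.updateRow_apply]
    have hup' : (Matrix.of ![p, v, w, q]).updateRow 1 v = Matrix.of ![p, v, w, q] := by
      ext i j
      fin_cases i <;> simp [Matrix.updateRow_apply]
    rw [hup, Matrix.det_updateRow_smul, hup', ← hD, inv_mul_cancel₀ hD0]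

end Frames

/-! ### The lines `ρ(P)` in vector form -/

section Lines

variable {F K : Type*} [Field F] [Fintype F] [Field K] [Algebra F K]

variable (F) in
/-- The vectors of `V̂` of the form `τ(κ(p, y))` with `y ⊥ p`. -/
def lineOf (μ : K) (p : Fin 4 → K) : Submodule F (Vhat F K) where
  carrier := {v | ∃ y, herm F y p = 0 ∧ (v : Fin 6 → K) = tauPluecker F μ p y}
  add_mem' := by
    rintro v w ⟨y, hy, hv⟩ ⟨z, hz, hw⟩
    refine ⟨y + z, by rw [herm_add_left, hy, hz, add_zero], ?_⟩
    rw [tauPluecker_add_right, ← hv, ← hw]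
    rfl
  zero_mem' := ⟨0, by simp [herm], by ext i; fin_cases i <;> simp [tauPluecker_eq]⟩
  smul_mem' := by
    rintro c v ⟨y, hy, hv⟩
    refine ⟨algebraMap F K c • y, by rw [herm_smul_left, hy, mul_zero], ?_⟩
    rw [tauPluecker_smul_right, ← hv]
    ext i
    simp [Algebra.smul_def]

theorem mem_lineOf {μ : K} {p : Fin 4 → K} {v : Vhat F K} :
    v ∈ lineOf F μ p ↔ ∃ y, herm F y p = 0 ∧ (v : Fin 6 → K) = tauPluecker F μ p y := Iff.rfl

theorem lineOf_smul (μ : K) {c : K} (hc : c ≠ 0) (p : Fin 4 → K) :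
    lineOf F μ (c • p) = lineOf F μ p := by
  ext v
  simp only [mem_lineOf, tauPluecker_smul_left]
  constructor
  · rintro ⟨y, hy, hv⟩
    rw [herm_smul_right] at hy
    refine ⟨c • y, ?_, by rw [hv, tauPluecker_smul_right]⟩
    rw [herm_smul_left, (mul_eq_zero.1 hy).resolve_left (conj_eq_zero.not.2 hc), mul_zero]
  · rintro ⟨y, hy, hv⟩
    refine ⟨c⁻¹ • y, ?_, ?_⟩
    · rw [herm_smul_left, herm_smul_right, hy, mul_zero, mul_zero]
    · rw [hv, tauPluecker_smul_right, smul_smul, mul_inv_cancel₀ hc, one_smul]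

theorem tauPluecker_eq_zero_of_mem_span {μ : K} {p y : Fin 4 → K}
    (h : y ∈ Submodule.span K {p}) : tauPluecker F μ p y = 0 := by
  obtain ⟨c, rfl⟩ := Submodule.mem_span_singleton.1 h
  rw [tauPluecker_smul_right, tauPluecker_self, smul_zero]

theorem finrank_span_pair_of_notMem {p y : Fin 4 → K} (hp : p ≠ 0)
    (hy : y ∉ Submodule.span K {p}) : Module.finrank K (Submodule.span K {p, y}) = 2 := by
  have hli : LinearIndependent K ![p, y] :=
    (LinearIndependent.pair_iff' hp).2 fun a ha =>
      hy (Submodule.mem_span_singleton.2 ⟨a, ha⟩)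
  have := finrank_span_eq_card hli
  rwa [Matrix.range_cons_cons_empty, Fintype.card_fin] at this

/-- The set `lineOf` does not ask `y` to be isotropic: membership of `τ(κ(p, y))` in `V̂` forces it,
so `⟨p, y⟩` is totally isotropic as soon as it is a line. -/
theorem rhoPoint_eq (hdeg : Module.finrank F K = 2) {μ : K} (hμ : μ * conj F μ = -1)
    (P : Projectivization K (Fin 4 → K)) (hP : IsHermitianPoint F P) :
    rhoPoint F μ P = lineOf F μ P.rep := by
  have hp0 := P.rep_nonzero
  have hpp : herm F P.rep P.rep = 0 := hP
  have hsub : P.submodule = Submodule.span K {P.rep} := P.submodule_eq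
  generalize P.rep = p at hp0 hpp hsub
  apply le_antisymm
  · refine Submodule.span_le.2 ?_
    rintro v ⟨r, ⟨hr, hiso⟩, hPr, hv⟩
    rw [hsub] at hPr
    have hpr : p ∈ r := hPr (Submodule.mem_span_singleton_self p)
    obtain ⟨y, hyr, hy⟩ : ∃ y ∈ r, y ∉ Submodule.span K {p} := by
      by_contra! hcon
      have h1 := Submodule.finrank_mono (R := K) (show r ≤ Submodule.span K {p} from hcon)
      rw [hr, finrank_span_singleton hp0] at h1
      omega
    have hrs : Submodule.span K {p, y} = r := by
      refine Submodule.eq_of_le_of_finrank_eq ?_ ?_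
      · rw [Submodule.span_le]
        rintro z (rfl | rfl) <;> assumption
      · rw [finrank_span_pair_of_notMem hp0 hy, hr]
    -- A change of the pair of vectors in `⟨p, y⟩` multiplies the Plücker vector by the determinant
    -- `ad - bc`.
    have hle : rhoLine F μ r ≤ Submodule.span K {tauPluecker F μ p y} := by
      rw [rhoLine, klein, Submodule.map_span, Submodule.span_le]
      rintro _ ⟨_, ⟨x, hx, z, hz, rfl⟩, rfl⟩
      rw [← hrs] at hx hz
      obtain ⟨a, b, rfl⟩ := Submodule.mem_span_pair.1 hx
      obtain ⟨c, d, rfl⟩ := Submodule.mem_span_pair.1 hz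
      refine Submodule.mem_span_singleton.2 ⟨a * d - b * c, ?_⟩
      change _ = tauPluecker F μ _ _
      ext i
      fin_cases i <;> simp [tauPluecker_eq] <;> ring
    obtain ⟨c, hc⟩ := Submodule.mem_span_singleton.1 (hle hv)
    refine ⟨c • y, ?_, ?_⟩
    · rw [herm_smul_left, hiso y hyr p hpr, mul_zero]
    · rw [tauPluecker_smul_right, hc]
  · rintro v ⟨y, hyp, hv⟩
    by_cases hy : y ∈ Submodule.span K {p}
    · rw [tauPluecker_eq_zero_of_mem_span hy] at hv
      have : v = 0 := Subtype.ext hv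
      rw [this]
      exact Submodule.zero_mem _
    have hpy := herm_comm_zero hdeg hyp
    have hyy : herm F y y = 0 := by
      -- As `v* = v`, its pairing with `τ(κ(y, z))` can be computed in two ways: it is zero because
      -- the row `y` is repeated, and it is `h(y, y) h(z, p)` with `h(z, p) = 1`.
      obtain ⟨z, hz⟩ := exists_herm_eq_one (F := F) hp0
      have hstar := (mem_Vhat_iff hdeg).1 v.2
      rw [hv] at hstar
      have h1 := polarForm_star6_tauPluecker hdeg hμ p y y z
      rw [hstar, polarForm_tauPluecker, hyp, hz, Matrix.det_zero_of_row_eq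
        (i := 1) (j := 2) (by decide) rfl] at h1
      linear_combination -h1
    refine Submodule.subset_span ⟨Submodule.span K {p, y}, ⟨?_, ?_⟩, ?_, ?_⟩
    · exact finrank_span_pair_of_notMem hp0 hy
    · intro x hx z hz
      obtain ⟨a, b, rfl⟩ := Submodule.mem_span_pair.1 hx
      obtain ⟨c, d, rfl⟩ := Submodule.mem_span_pair.1 hz
      simp [herm_add_left, herm_add_right, herm_smul_left, herm_smul_right, hpp, hpy, hyp, hyy]
    · rw [hsub]
      exact Submodule.span_mono (by simp)
    · rw [hv]
      refine Submodule.mem_map_of_mem (Submodule.subset_span ⟨p, ?_, y, ?_, rfl⟩)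
      · exact Submodule.subset_span (by simp)
      · exact Submodule.subset_span (by simp)

theorem map_lineOf {μ : K} (hμ : μ * conj F μ = -1)
    {f : Fin 4 → Fin 4 → K} (hf : IsFrame F f) {e : Vhat F K ≃ₗ[F] Vhat F K}
    (he : ∀ v, (e v : Fin 6 → K) = frameMap6 F μ f v) (p : Fin 4 → K) :
    (lineOf F μ p).map (e : Vhat F K →ₗ[F] Vhat F K) = lineOf F μ (frameMap f p) := by
  ext w
  constructor
  · rintro ⟨v, ⟨y, hy, hv⟩, rfl⟩
    refine ⟨frameMap f y, by rw [hf.herm_map, hy], ?_⟩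
    rw [LinearEquiv.coe_coe, he, hv, frameMap6_tauPluecker hμ]
  · rintro ⟨z, hz, hw⟩
    obtain ⟨y, rfl⟩ := hf.surjective z
    rw [hf.herm_map] at hz
    refine ⟨e.symm w, ⟨y, hz, ?_⟩, by simp⟩
    apply frameMap6_injective hμ hf
    rw [← he, frameMap6_tauPluecker hμ, ← hw, e.apply_symm_apply]

theorem mem_perp {W : Submodule F (Vhat F K)} {v : Vhat F K} :
    v ∈ perp W ↔ ∀ w ∈ W, polarForm (v : Fin 6 → K) w = 0 := by
  simp only [← polar_quadQ]; rfl

theorem map_perp {μ : K} (hμ : μ * conj F μ = -1)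
    {f : Fin 4 → Fin 4 → K} (hf : IsFrame F f) {e : Vhat F K ≃ₗ[F] Vhat F K}
    (he : ∀ v, (e v : Fin 6 → K) = frameMap6 F μ f v) (W : Submodule F (Vhat F K)) :
    (perp W).map (e : Vhat F K →ₗ[F] Vhat F K) =
      perp (W.map (e : Vhat F K →ₗ[F] Vhat F K)) := by
  have hpol : ∀ v w, polarForm (e v : Fin 6 → K) (e w) = polarForm (v : Fin 6 → K) w :=
    fun v w => by rw [he, he, polarForm_frameMap6 hμ hf]
  ext v
  constructor
  · rintro ⟨v, hv, rfl⟩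
    rw [mem_perp]
    rintro _ ⟨w, hw, rfl⟩
    exact (hpol v w).trans (mem_perp.1 hv w hw)
  · intro hv
    refine ⟨e.symm v, mem_perp.2 fun w hw => ?_, by simp⟩
    rw [← hpol, e.apply_symm_apply]
    exact mem_perp.1 hv _ ⟨w, hw, rfl⟩

end Lines

/-! ### Transport of perspectivity by isometries -/

section Perspective

theorem InPerspectiveWith.map {F U U' : Type*} [Field F] [AddCommGroup U] [Module F U]
    [AddCommGroup U'] [Module F U'] {l T : Fin 3 → Submodule F U} (h : InPerspectiveWith l T)
    (e : U ≃ₗ[F] U') :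
    InPerspectiveWith (fun i => (l i).map (e : U →ₗ[F] U'))
      (fun i => (T i).map (e : U →ₗ[F] U')) := by
  have hinj : Function.Injective (e : U →ₗ[F] U') := e.injective
  have hfr : ∀ W : Submodule F U,
      Module.finrank F (W.map (e : U →ₗ[F] U')) = Module.finrank F W :=
    fun W => LinearEquiv.finrank_map_eq e W
  refine ⟨fun i => (hfr _).trans (h.finrank_line i), fun i j hij => ?_,
    fun i => (hfr _).trans (h.finrank_solid i), fun i => Submodule.map_mono (h.line_le_solid i),
    fun i j hij => ?_, ?_⟩
  · exact (Submodule.disjoint_map hinj (h.line_skew i j hij))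
  · exact (Submodule.disjoint_map hinj (h.solid_skew i j hij))
  · obtain ⟨L, hL, h0, h1, h2⟩ := h.share_line
    refine ⟨L.map (e : U →ₗ[F] U'), (hfr L).trans hL, ?_, ?_, ?_⟩ <;>
    · rw [← Submodule.map_inf _ hinj, ← Submodule.map_sup]
      exact Submodule.map_mono ‹_›

theorem inPerspective_map_iff {F K : Type*} [Field F] [Fintype F] [Field K] [Algebra F K]
    {e : Vhat F K ≃ₗ[F] Vhat F K}
    (he : ∀ W, (perp W).map (e : Vhat F K →ₗ[F] Vhat F K) =
      perp (W.map (e : Vhat F K →ₗ[F] Vhat F K))) (l m n : Submodule F (Vhat F K)) :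
    InPerspective (l.map (e : Vhat F K →ₗ[F] Vhat F K)) (m.map (e : Vhat F K →ₗ[F] Vhat F K))
      (n.map (e : Vhat F K →ₗ[F] Vhat F K)) ↔ InPerspective l m n := by
  have hs : ∀ W : Submodule F (Vhat F K),
      (W.map (e : Vhat F K →ₗ[F] Vhat F K)).map (e.symm : Vhat F K →ₗ[F] Vhat F K) = W := by
    intro W
    rw [← Submodule.map_comp]
    simp
  unfold InPerspective
  constructor
  · intro h
    have h' := h.map e.symm
    convert h' using 2 with i i
    · fin_cases i <;> exact (hs _).symm
    · rw [← he, ← he, ← he]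
      fin_cases i <;> exact (hs _).symm
  · intro h
    have h' := h.map e
    convert h' using 2 with i i
    · fin_cases i <;> rfl
    · rw [← he, ← he, ← he]
      fin_cases i <;> rfl

end Perspective

/-! ### Dimension counts by linear projection -/

section Finrank

variable {F U V : Type*} [Field F] [AddCommGroup U] [Module F U] [AddCommGroup V] [Module F V]

theorem injective_domRestrict {W : Submodule F U} {φ : U →ₗ[F] V}
    (hinj : ∀ v ∈ W, φ v = 0 → v = 0) : Function.Injective (φ.domRestrict W) :=
  (injective_iff_map_eq_zero _).2 fun v hv => Subtype.ext (hinj v v.2 hv)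

theorem finrank_eq_of_bijOn (W : Submodule F U) (φ : U →ₗ[F] V)
    (hinj : ∀ v ∈ W, φ v = 0 → v = 0) (hsurj : ∀ x, ∃ v ∈ W, φ v = x) :
    Module.finrank F W = Module.finrank F V :=
  (LinearEquiv.ofBijective (φ.domRestrict W) ⟨injective_domRestrict hinj, fun x =>
    let ⟨v, hv, hx⟩ := hsurj x
    ⟨⟨v, hv⟩, hx⟩⟩).finrank_eq

theorem exists_mem_eq_of_finrank_eq [Module.Finite F V] {W : Submodule F U} {φ : U →ₗ[F] V}
    (hinj : ∀ v ∈ W, φ v = 0 → v = 0) (hfin : Module.finrank F W = Module.finrank F V) (x : V) :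
    ∃ v ∈ W, φ v = x := by
  have := Module.Finite.of_injective _ (injective_domRestrict hinj)
  obtain ⟨v, hv⟩ := (LinearMap.injective_iff_surjective_of_finrank_eq_finrank hfin).1
    (injective_domRestrict hinj) x
  exact ⟨v, v.2, hv⟩

end Finrank

/-! ### Computation in normalized coordinates -/

section Coordinates

variable {F K : Type*} [Field F] [Fintype F] [Field K] [Algebra F K]

theorem Vhat_ext {v w : Vhat F K} (h0 : (v : Fin 6 → K) 0 = (w : Fin 6 → K) 0)
    (h2 : (v : Fin 6 → K) 2 = (w : Fin 6 → K) 2) (h4 : (v : Fin 6 → K) 4 = (w : Fin 6 → K) 4) :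
    v = w := by
  obtain ⟨v, v1, v3, v5⟩ := v
  obtain ⟨w, w1, w3, w5⟩ := w
  simp only at h0 h2 h4
  apply Subtype.ext
  ext i
  fin_cases i <;> simp [*]

theorem Vhat_one (v : Vhat F K) : (v : Fin 6 → K) 1 = conj F ((v : Fin 6 → K) 0) := v.2.1

theorem Vhat_three (v : Vhat F K) : (v : Fin 6 → K) 3 = conj F ((v : Fin 6 → K) 2) := v.2.2.1

theorem Vhat_five (v : Vhat F K) : (v : Fin 6 → K) 5 = conj F ((v : Fin 6 → K) 4) := v.2.2.2

variable (F) in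
/-- The vector `(x, x^q, y, y^q, z, z^q)` of `V̂`. -/
def vhatMk (x y z : K) : Vhat F K :=
  ⟨![x, conj F x, y, conj F y, z, conj F z], rfl, rfl, rfl⟩

@[simp] theorem vhatMk_zero (x y z : K) : (vhatMk F x y z : Fin 6 → K) 0 = x := rfl

@[simp] theorem vhatMk_two (x y z : K) : (vhatMk F x y z : Fin 6 → K) 2 = y := rfl

@[simp] theorem vhatMk_four (x y z : K) : (vhatMk F x y z : Fin 6 → K) 4 = z := rfl

variable (F K) in
/-- The coordinate functions on `V̂`. -/
def coord (i : Fin 6) : Vhat F K →ₗ[F] K :=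
  (LinearMap.proj i : (Fin 6 → K) →ₗ[F] K) ∘ₗ (Vhat F K).subtype

theorem finrank_of_coord (hdeg : Module.finrank F K = 2) {W : Submodule F (Vhat F K)} (i : Fin 6)
    (hinj : ∀ v ∈ W, (v : Fin 6 → K) i = 0 → v = 0)
    (hsurj : ∀ x : K, ∃ v ∈ W, (v : Fin 6 → K) i = x) : Module.finrank F W = 2 :=
  (finrank_eq_of_bijOn W (coord F K i) hinj hsurj).trans hdeg

theorem finrank_of_coord_pair (hdeg : Module.finrank F K = 2) {W : Submodule F (Vhat F K)}
    (i j : Fin 6)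
    (hinj : ∀ v ∈ W, (v : Fin 6 → K) i = 0 → (v : Fin 6 → K) j = 0 → v = 0)
    (hsurj : ∀ x y : K, ∃ v ∈ W, (v : Fin 6 → K) i = x ∧ (v : Fin 6 → K) j = y) :
    Module.finrank F W = 4 := by
  have : Module.Finite F K := Module.finite_of_finrank_pos (by omega)
  refine (finrank_eq_of_bijOn W ((coord F K i).prod (coord F K j))
    (fun v hv h => hinj v hv (congrArg Prod.fst h) (congrArg Prod.snd h)) fun x => ?_).trans ?_
  · obtain ⟨v, hv, h1, h2⟩ := hsurj x.1 x.2
    exact ⟨v, hv, Prod.ext h1 h2⟩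
  · rw [Module.finrank_prod, hdeg]

variable {μ a b c : K}

theorem mem_lineOf_first (hμ : μ * conj F μ = -1) {v : Vhat F K} :
    v ∈ lineOf F μ ![1, 0, 0, 0] ↔ (v : Fin 6 → K) 2 = 0 ∧ (v : Fin 6 → K) 4 = 0 := by
  constructor
  · rintro ⟨y, hy, hv⟩
    simp [herm, conj_zero, conj_one] at hy
    rw [hv]
    simp [tauPluecker_eq, hy]
  · rintro ⟨h2, h4⟩
    refine ⟨![0, (v : Fin 6 → K) 0, μ * (v : Fin 6 → K) 1, 0], ?_, ?_⟩
    · simp [herm, conj_zero]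
    · ext i
      fin_cases i <;> simp [tauPluecker_eq, h2, h4, Vhat_three, Vhat_five, conj_zero]
      linear_combination (v : Fin 6 → K) 1 * hμ

theorem mem_lineOf_last (hμ : μ * conj F μ = -1) {v : Vhat F K} :
    v ∈ lineOf F μ ![0, 0, 0, 1] ↔ (v : Fin 6 → K) 0 = 0 ∧ (v : Fin 6 → K) 2 = 0 := by
  constructor
  · rintro ⟨y, hy, hv⟩
    simp [herm, conj_zero, conj_one] at hy
    rw [hv]
    simp [tauPluecker_eq, hy]
  · rintro ⟨h0, h2⟩
    refine ⟨![0, -(v : Fin 6 → K) 4, μ * (v : Fin 6 → K) 5, 0], ?_, ?_⟩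
    · simp [herm, conj_zero]
    · ext i
      fin_cases i <;> simp [tauPluecker_eq, h0, h2, Vhat_one, Vhat_three, conj_zero]
      linear_combination (v : Fin 6 → K) 5 * hμ

/-- The condition `ha` says that `(1, b, c, a)` is isotropic. The line is a graph over the
coordinate `X`. -/
theorem mem_lineOf_generic (hdeg : Module.finrank F K = 2) (hμ : μ * conj F μ = -1)
    (ha : a + conj F a = b * conj F b + c * conj F c) {v : Vhat F K} :
    v ∈ lineOf F μ ![1, b, c, a] ↔
      (v : Fin 6 → K) 2 = conj F b * (v : Fin 6 → K) 0 +
        μ * conj F c * conj F ((v : Fin 6 → K) 0) ∧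
      (v : Fin 6 → K) 4 = (b * conj F b - a) * (v : Fin 6 → K) 0 +
        μ * b * conj F c * conj F ((v : Fin 6 → K) 0) := by
  constructor
  · rintro ⟨y, hy, hv⟩
    have h0 : (v : Fin 6 → K) 0 = y 1 - b * y 0 := by rw [hv]; simp [tauPluecker_eq]
    have h1 : (v : Fin 6 → K) 1 = -(conj F μ) * (y 2 - c * y 0) := by
      rw [hv]; simp [tauPluecker_eq]
    have h2 : (v : Fin 6 → K) 2 = y 3 - a * y 0 := by rw [hv]; simp [tauPluecker_eq]
    have h4 : (v : Fin 6 → K) 4 = b * y 3 - a * y 1 := by rw [hv]; simp [tauPluecker_eq]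
    have hy' : y 0 * conj F a - y 1 * conj F b - y 2 * conj F c + y 3 = 0 := by
      simpa [herm, conj_one] using hy
    rw [← Vhat_one, h0, h1, h2, h4]
    constructor
    · linear_combination hy' - y 0 * ha + conj F c * (y 2 - c * y 0) * hμ
    · linear_combination b * hy' - b * y 0 * ha + b * conj F c * (y 2 - c * y 0) * hμ
  · rintro ⟨h2, h4⟩
    -- Adding a multiple of `(1, b, c, a)` to `y` changes nothing, so `y₀ = 0` may be assumed; the
    -- first three coordinates of `v` then give the rest of `y`.
    refine ⟨![0, (v : Fin 6 → K) 0, μ * (v : Fin 6 → K) 1, (v : Fin 6 → K) 2], ?_, ?_⟩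
    · simp [herm, h2, Vhat_one, conj_one]
      ring
    · ext i
      fin_cases i <;> simp [tauPluecker_eq]
      · linear_combination (v : Fin 6 → K) 1 * hμ
      · rw [Vhat_three, Vhat_one, h2, conj_add, conj_mul, conj_mul, conj_mul, conj_conj hdeg,
          conj_conj hdeg, conj_conj hdeg]
        linear_combination b * conj F ((v : Fin 6 → K) 0) * hμ
      · rw [h2, h4]
        ring
      · rw [Vhat_five, Vhat_one, h2, h4]
        simp only [conj_add, conj_mul, conj_sub, conj_conj hdeg]
        linear_combination (conj F ((v : Fin 6 → K) 0)) * (a * hμ - ha - c * conj F c * hμ)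

/-- A vector of the line has one free parameter `x` in `K`, and its pairing with `v` is a trace `kx
+ k̄ x̄`. Orthogonality is therefore the single equation `k = 0` over `K`; the same holds for the
other two lines. -/
theorem mem_perp_first (hdeg : Module.finrank F K = 2) (hμ : μ * conj F μ = -1)
    {v : Vhat F K} :
    v ∈ perp (lineOf F μ ![1, 0, 0, 0]) ↔ (v : Fin 6 → K) 4 = 0 := by
  rw [mem_perp]
  constructor
  · intro h
    refine (conj_eq_zero (F := F)).1 (eq_zero_of_trace_mul_eq_zero (F := F) hdeg fun x => ?_)
    have h' := h (vhatMk F x 0 0) ((mem_lineOf_first hμ).2 ⟨rfl, rfl⟩)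
    simp only [polarForm, Vhat_one, Vhat_three, Vhat_five, vhatMk_zero, vhatMk_two, vhatMk_four,
      conj_zero] at h'
    rw [conj_conj hdeg]
    linear_combination -h'
  · intro h w hw
    obtain ⟨h2, h4⟩ := (mem_lineOf_first hμ).1 hw
    simp [polarForm, Vhat_one, Vhat_three, Vhat_five, h, h2, h4, conj_zero]

theorem mem_perp_last (hdeg : Module.finrank F K = 2) (hμ : μ * conj F μ = -1)
    {v : Vhat F K} :
    v ∈ perp (lineOf F μ ![0, 0, 0, 1]) ↔ (v : Fin 6 → K) 0 = 0 := by
  rw [mem_perp]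
  constructor
  · intro h
    refine (conj_eq_zero (F := F)).1 (eq_zero_of_trace_mul_eq_zero (F := F) hdeg fun x => ?_)
    have h' := h (vhatMk F 0 0 x) ((mem_lineOf_last hμ).2 ⟨rfl, rfl⟩)
    simp only [polarForm, Vhat_one, Vhat_three, Vhat_five, vhatMk_zero, vhatMk_two, vhatMk_four,
      conj_zero] at h'
    rw [conj_conj hdeg]
    linear_combination -h'
  · intro h w hw
    obtain ⟨h0, h2⟩ := (mem_lineOf_last hμ).1 hw
    simp [polarForm, Vhat_one, Vhat_three, h, h0, h2, conj_zero]

theorem mem_perp_generic (hdeg : Module.finrank F K = 2) (hμ : μ * conj F μ = -1)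
    (ha : a + conj F a = b * conj F b + c * conj F c) {v : Vhat F K} :
    v ∈ perp (lineOf F μ ![1, b, c, a]) ↔
      conj F b * conj F ((v : Fin 6 → K) 2) + conj F μ * c * (v : Fin 6 → K) 2 -
        (b * conj F b - a) * conj F ((v : Fin 6 → K) 0) -
        conj F μ * conj F b * c * (v : Fin 6 → K) 0 - conj F ((v : Fin 6 → K) 4) = 0 := by
  rw [mem_perp]
  constructor
  · intro h
    refine eq_zero_of_trace_mul_eq_zero (F := F) hdeg fun x => ?_
    have h' := h (vhatMk F x (conj F b * x + μ * conj F c * conj F x)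
      ((b * conj F b - a) * x + μ * b * conj F c * conj F x))
      ((mem_lineOf_generic hdeg hμ ha).2 ⟨rfl, rfl⟩)
    simp only [polarForm, Vhat_one, Vhat_three, Vhat_five, vhatMk_zero, vhatMk_two, vhatMk_four,
      conj_add, conj_mul, conj_sub, conj_conj hdeg] at h' ⊢
    linear_combination h'
  · intro h w hw
    obtain ⟨h2, h4⟩ := (mem_lineOf_generic hdeg hμ ha).1 hw
    have hc := congrArg (conj F) h
    simp only [polarForm, Vhat_one, Vhat_three, Vhat_five, h2, h4, conj_zero,
      conj_add, conj_mul, conj_sub, conj_conj hdeg] at hc ⊢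
    linear_combination (w : Fin 6 → K) 0 * h + conj F ((w : Fin 6 → K) 0) * hc

/-- The line contributes an arbitrary `X`, and the intersection `X = 0` leaves only the relation
between `Y` and `Z`. The next two lemmas have the same shape. -/
theorem mem_sup_first (hdeg : Module.finrank F K = 2) (hμ : μ * conj F μ = -1)
    (ha : a + conj F a = b * conj F b + c * conj F c) {v : Vhat F K} :
    v ∈ lineOf F μ ![1, 0, 0, 0] ⊔
        (perp (lineOf F μ ![0, 0, 0, 1]) ⊓ perp (lineOf F μ ![1, b, c, a])) ↔
      conj F ((v : Fin 6 → K) 4) =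
        conj F b * conj F ((v : Fin 6 → K) 2) + conj F μ * c * (v : Fin 6 → K) 2 := by
  rw [Submodule.mem_sup]
  simp only [Submodule.mem_inf, mem_lineOf_first hμ, mem_perp_last hdeg hμ,
    mem_perp_generic hdeg hμ ha]
  constructor
  · rintro ⟨u, ⟨hu2, hu4⟩, w, ⟨hw0, hw⟩, rfl⟩
    simp only [Submodule.coe_add, Pi.add_apply, hu2, hu4, zero_add]
    rw [hw0, conj_zero] at hw
    linear_combination -hw
  · intro h
    refine ⟨vhatMk F ((v : Fin 6 → K) 0) 0 0, ⟨rfl, rfl⟩,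
      vhatMk F 0 ((v : Fin 6 → K) 2) ((v : Fin 6 → K) 4), ⟨rfl, ?_⟩, ?_⟩
    · simp only [vhatMk_zero, vhatMk_two, vhatMk_four, conj_zero]
      linear_combination -h
    · apply Vhat_ext <;> simp

theorem mem_sup_last (hdeg : Module.finrank F K = 2) (hμ : μ * conj F μ = -1)
    (ha : a + conj F a = b * conj F b + c * conj F c) {v : Vhat F K} :
    v ∈ lineOf F μ ![0, 0, 0, 1] ⊔
        (perp (lineOf F μ ![1, 0, 0, 0]) ⊓ perp (lineOf F μ ![1, b, c, a])) ↔
      (b * conj F b - a) * conj F ((v : Fin 6 → K) 0) +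
          conj F μ * conj F b * c * (v : Fin 6 → K) 0 =
        conj F b * conj F ((v : Fin 6 → K) 2) + conj F μ * c * (v : Fin 6 → K) 2 := by
  rw [Submodule.mem_sup]
  simp only [Submodule.mem_inf, mem_lineOf_last hμ, mem_perp_first hdeg hμ,
    mem_perp_generic hdeg hμ ha]
  constructor
  · rintro ⟨u, ⟨hu0, hu2⟩, w, ⟨hw4, hw⟩, rfl⟩
    simp only [Submodule.coe_add, Pi.add_apply, hu0, hu2, zero_add]
    rw [hw4, conj_zero] at hw
    linear_combination -hw
  · intro h
    refine ⟨vhatMk F 0 0 ((v : Fin 6 → K) 4), ⟨rfl, rfl⟩,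
      vhatMk F ((v : Fin 6 → K) 0) ((v : Fin 6 → K) 2) 0, ⟨rfl, ?_⟩, ?_⟩
    · simp only [vhatMk_zero, vhatMk_two, vhatMk_four, conj_zero]
      linear_combination -h
    · apply Vhat_ext <;> simp

theorem mem_sup_generic (hdeg : Module.finrank F K = 2) (hμ : μ * conj F μ = -1)
    (ha : a + conj F a = b * conj F b + c * conj F c) {v : Vhat F K} :
    v ∈ lineOf F μ ![1, b, c, a] ⊔
        (perp (lineOf F μ ![1, 0, 0, 0]) ⊓ perp (lineOf F μ ![0, 0, 0, 1])) ↔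
      (v : Fin 6 → K) 4 = (b * conj F b - a) * (v : Fin 6 → K) 0 +
        μ * b * conj F c * conj F ((v : Fin 6 → K) 0) := by
  rw [Submodule.mem_sup]
  simp only [Submodule.mem_inf, mem_lineOf_generic hdeg hμ ha, mem_perp_first hdeg hμ,
    mem_perp_last hdeg hμ]
  constructor
  · rintro ⟨u, ⟨hu2, hu4⟩, w, ⟨hw4, hw0⟩, rfl⟩
    simp only [Submodule.coe_add, Pi.add_apply, hw4, hw0, add_zero, hu4]
  · intro h
    refine ⟨vhatMk F ((v : Fin 6 → K) 0) (conj F b * (v : Fin 6 → K) 0 +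
        μ * conj F c * conj F ((v : Fin 6 → K) 0)) ((v : Fin 6 → K) 4), ⟨rfl, h⟩,
      vhatMk F 0 ((v : Fin 6 → K) 2 - (conj F b * (v : Fin 6 → K) 0 +
        μ * conj F c * conj F ((v : Fin 6 → K) 0))) 0, ⟨rfl, rfl⟩, ?_⟩
    apply Vhat_ext <;> simp

/-- The map `x ↦ αx + βx̄` has determinant `αᾱ - ββ̄` over `F`, and here this equals `a ā`. -/
theorem eq_zero_of_generic (hdeg : Module.finrank F K = 2) (hμ : μ * conj F μ = -1)
    (ha : a + conj F a = b * conj F b + c * conj F c) (ha0 : a ≠ 0) {x : K}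
    (hx : (b * conj F b - a) * x + μ * b * conj F c * conj F x = 0) : x = 0 := by
  have hc := congrArg (conj F) hx
  simp only [conj_add, conj_mul, conj_sub, conj_conj hdeg, conj_zero] at hc
  have h : a * conj F a * x = 0 := by
    linear_combination (conj F b * b - conj F a) * hx - μ * b * conj F c * hc
      + x * b * conj F b * ha
      + x * b * conj F b * c * conj F c * hμ
  exact (mul_eq_zero.1 h).resolve_left (mul_ne_zero ha0 (conj_eq_zero.not.2 ha0))

/-- In coordinates adapted to the first two points, the lines are in perspective if and only if the
last coordinate of the third vector lies in the subfield. -/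
theorem inPerspective_normalForm_iff (hdeg : Module.finrank F K = 2) (hμ : μ * conj F μ = -1)
    (ha : a + conj F a = b * conj F b + c * conj F c) (ha0 : a ≠ 0) (hbc : ¬ (b = 0 ∧ c = 0)) :
    InPerspective (lineOf F μ ![1, 0, 0, 0]) (lineOf F μ ![0, 0, 0, 1])
      (lineOf F μ ![1, b, c, a]) ↔ conj F a = a := by
  have hμ0 : conj F μ ≠ 0 := fun h => by simp [h] at hμ
  constructor
  · intro hper
    by_contra hne
    obtain ⟨L, hL, h0, h1, h2⟩ := hper.share_line
    have hcoords : ∀ v ∈ L, (v : Fin 6 → K) 0 = 0 ∧ (v : Fin 6 → K) 4 = 0 ∧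
        conj F b * conj F ((v : Fin 6 → K) 2) + conj F μ * c * (v : Fin 6 → K) 2 = 0 := by
      intro v hv
      have k0 := (mem_sup_first hdeg hμ ha).1 (h0 hv)
      have k1 := (mem_sup_last hdeg hμ ha).1 (h1 hv)
      have k2 := (mem_sup_generic hdeg hμ ha).1 (h2 hv)
      have k2c := congrArg (conj F) k2
      simp only [conj_add, conj_mul, conj_sub, conj_conj hdeg] at k2c
      -- The second span equation minus the conjugate of the third, simplified by the first.
      have hprod : (conj F a - a) * conj F ((v : Fin 6 → K) 0) = 0 := by
        linear_combination k1 - k0 + k2c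
      have hv0 : (v : Fin 6 → K) 0 = 0 :=
        conj_eq_zero.1 ((mul_eq_zero.1 hprod).resolve_left (sub_ne_zero.2 hne))
      rw [hv0, conj_zero] at k1 k2
      refine ⟨hv0, ?_, ?_⟩
      · linear_combination k2
      · linear_combination -k1
    have : Module.Finite F K := Module.finite_of_finrank_pos (by omega)
    have hinj : ∀ v ∈ L, coord F K 2 v = 0 → v = 0 := fun v hv h =>
      Vhat_ext (hcoords v hv).1 h (hcoords v hv).2.1
    -- On `L` only the coordinate `Y` survives. Both `L` and `K` have dimension two over `F`, so `Y`
    -- takes every value, and `w = 0` forces `b = c = 0`.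
    have hall : ∀ y : K, conj F b * conj F y + conj F μ * c * y = 0 := by
      intro y
      obtain ⟨v, hv, rfl⟩ := exists_mem_eq_of_finrank_eq hinj (hL.trans hdeg.symm) y
      exact (hcoords v hv).2.2
    obtain ⟨y, hy⟩ := exists_conj_ne (F := F) (K := K) hdeg
    have e1 := hall 1
    rw [conj_one] at e1
    have e2 : conj F b * (conj F y - y) = 0 := by linear_combination hall y - y * e1
    have hb := conj_eq_zero.1 ((mul_eq_zero.1 e2).resolve_right (sub_ne_zero.2 hy))
    rw [hb, conj_zero] at e1
    have hc : conj F μ * c = 0 := by linear_combination e1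
    exact hbc ⟨hb, (mul_eq_zero.1 hc).resolve_left hμ0⟩
  · intro haF
    have hle : ∀ i, (![lineOf F μ ![1, 0, 0, 0], lineOf F μ ![0, 0, 0, 1],
        lineOf F μ ![1, b, c, a]] : Fin 3 → Submodule F (Vhat F K)) i ≤
        (![perp (lineOf F μ ![1, 0, 0, 0]), perp (lineOf F μ ![0, 0, 0, 1]),
        perp (lineOf F μ ![1, b, c, a])] : Fin 3 → Submodule F (Vhat F K)) i := by
      intro i v hv
      fin_cases i
      · exact (mem_perp_first hdeg hμ).2 ((mem_lineOf_first hμ).1 hv).2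
      · exact (mem_perp_last hdeg hμ).2 ((mem_lineOf_last hμ).1 hv).1
      · refine (mem_perp_generic hdeg hμ ha).2 ?_
        obtain ⟨h2, h4⟩ := (mem_lineOf_generic hdeg hμ ha).1 hv
        rw [h2, h4]
        simp only [conj_add, conj_mul, conj_sub, conj_conj hdeg]
        linear_combination conj F ((v : Fin 6 → K) 0) * (ha + c * conj F c * hμ)
    have hskew : ∀ i j, i ≠ j → Disjoint
        ((![perp (lineOf F μ ![1, 0, 0, 0]), perp (lineOf F μ ![0, 0, 0, 1]),
        perp (lineOf F μ ![1, b, c, a])] : Fin 3 → Submodule F (Vhat F K)) i)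
        ((![lineOf F μ ![1, 0, 0, 0], lineOf F μ ![0, 0, 0, 1],
        lineOf F μ ![1, b, c, a]] : Fin 3 → Submodule F (Vhat F K)) j) := by
      intro i j hij
      rw [Submodule.disjoint_def]
      intro v hT hl
      fin_cases i <;> fin_cases j <;> first | exact absurd rfl hij | skip
      · obtain ⟨h0, h2⟩ := (mem_lineOf_last hμ).1 hl
        exact Vhat_ext h0 h2 ((mem_perp_first hdeg hμ).1 hT)
      · obtain ⟨h2, h4⟩ := (mem_lineOf_generic hdeg hμ ha).1 hl
        have hz := (mem_perp_first hdeg hμ).1 hT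
        have h0 := eq_zero_of_generic hdeg hμ ha ha0 (h4.symm.trans hz)
        refine Vhat_ext h0 ?_ hz
        rw [h2, h0, conj_zero]; simp
      · obtain ⟨h2, h4⟩ := (mem_lineOf_first hμ).1 hl
        exact Vhat_ext ((mem_perp_last hdeg hμ).1 hT) h2 h4
      · obtain ⟨h2, h4⟩ := (mem_lineOf_generic hdeg hμ ha).1 hl
        have h0 := (mem_perp_last hdeg hμ).1 hT
        refine Vhat_ext h0 ?_ ?_
        · rw [h2, h0, conj_zero]; simp
        · rw [h4, h0, conj_zero]; simp
      · obtain ⟨h2, h4⟩ := (mem_lineOf_first hμ).1 hl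
        have hT' := (mem_perp_generic hdeg hμ ha).1 hT
        rw [h2, h4, conj_zero] at hT'
        have hc := congrArg (conj F) hT'
        simp only [conj_add, conj_mul, conj_sub, conj_conj hdeg, conj_zero] at hc
        refine Vhat_ext (eq_zero_of_generic hdeg hμ ha ha0 ?_) h2 h4
        rw [← haF]
        linear_combination -hc
      · obtain ⟨h0, h2⟩ := (mem_lineOf_last hμ).1 hl
        have hT' := (mem_perp_generic hdeg hμ ha).1 hT
        rw [h0, h2, conj_zero] at hT'
        refine Vhat_ext h0 h2 ((conj_eq_zero (F := F)).1 ?_)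
        linear_combination -hT'
    refine ⟨fun i => ?_, fun i j hij => (hskew i j hij).mono_left (hle i), fun i => ?_, hle,
      hskew, ?_⟩
    · fin_cases i
      · refine finrank_of_coord hdeg 0 (fun v hv h => ?_) fun x => ⟨vhatMk F x 0 0,
          (mem_lineOf_first hμ).2 ⟨rfl, rfl⟩, rfl⟩
        obtain ⟨h2, h4⟩ := (mem_lineOf_first hμ).1 hv
        exact Vhat_ext h h2 h4
      · refine finrank_of_coord hdeg 4 (fun v hv h => ?_) fun x => ⟨vhatMk F 0 0 x,
          (mem_lineOf_last hμ).2 ⟨rfl, rfl⟩, rfl⟩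
        obtain ⟨h0, h2⟩ := (mem_lineOf_last hμ).1 hv
        exact Vhat_ext h0 h2 h
      · refine finrank_of_coord hdeg 0 (fun v hv h => ?_) fun x => ⟨vhatMk F x
          (conj F b * x + μ * conj F c * conj F x)
          ((b * conj F b - a) * x + μ * b * conj F c * conj F x),
          (mem_lineOf_generic hdeg hμ ha).2 ⟨rfl, rfl⟩, rfl⟩
        obtain ⟨h2, h4⟩ := (mem_lineOf_generic hdeg hμ ha).1 hv
        refine Vhat_ext h ?_ ?_
        · rw [h2, h, conj_zero]; simp
        · rw [h4, h, conj_zero]; simp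
    · fin_cases i
      · exact finrank_of_coord_pair hdeg 0 2
          (fun v hv h0 h2 => Vhat_ext h0 h2 ((mem_perp_first hdeg hμ).1 hv))
          fun x y => ⟨vhatMk F x y 0, (mem_perp_first hdeg hμ).2 rfl, rfl, rfl⟩
      · exact finrank_of_coord_pair hdeg 2 4
          (fun v hv h2 h4 => Vhat_ext ((mem_perp_last hdeg hμ).1 hv) h2 h4)
          fun x y => ⟨vhatMk F 0 x y, (mem_perp_last hdeg hμ).2 rfl, rfl, rfl⟩
      · refine finrank_of_coord_pair hdeg 0 2 (fun v hv h0 h2 => Vhat_ext h0 h2 ?_)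
          fun x y => ⟨vhatMk F x y (conj F (conj F b * conj F y + conj F μ * c * y -
            (b * conj F b - a) * conj F x - conj F μ * conj F b * c * x)),
            (mem_perp_generic hdeg hμ ha).2 ?_, rfl, rfl⟩
        · have := (mem_perp_generic hdeg hμ ha).1 hv
          rw [h0, h2, conj_zero] at this
          refine (conj_eq_zero (F := F)).1 ?_
          linear_combination -this
        · simp only [vhatMk_zero, vhatMk_two, vhatMk_four]
          rw [conj_conj hdeg]
          ring
    · have hD : a * a ≠ 0 := mul_ne_zero ha0 ha0
      let wf : K → K := fun y => b * y + μ * conj F c * conj F y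
      let xf : K → K := fun y =>
        ((b * conj F b - a) * wf y - μ * b * conj F c * conj F (wf y)) / (a * a)
      have hwf : ∀ y, conj F (wf y) = conj F b * conj F y + conj F μ * c * y := fun y => by
        simp only [wf, conj_add, conj_mul, conj_conj hdeg]
      -- `xf y` solves `φ(X) = w(y)` by Cramer's rule; since `ā = a`, the leading coefficient of `φ`
      -- is self-conjugate and the determinant is `a²`.
      have hxf : ∀ y, (b * conj F b - a) * xf y + μ * b * conj F c * conj F (xf y) = wf y := by
        intro y
        simp only [xf]
        generalize wf y = w
        simp only [conj_div, conj_mul, conj_sub, conj_conj hdeg, haF]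
        rw [mul_div_assoc', mul_div_assoc', ← add_div, div_eq_iff hD]
        linear_combination -w * b * conj F b * (ha - haF) - w * b * conj F b * c * conj F c * hμ
      have hwadd : ∀ y y', wf (y + y') = wf y + wf y' := fun y y' => by
        simp only [wf, conj_add]; ring
      have hwsmul : ∀ (t : F) y, wf (t • y) = t • wf y := fun t y => by
        simp only [wf, Algebra.smul_def, conj_algebraMap_mul]; ring
      let L : Submodule F (Vhat F K) :=
        { carrier := {v | (v : Fin 6 → K) 0 = xf ((v : Fin 6 → K) 2) ∧
            (v : Fin 6 → K) 4 = wf ((v : Fin 6 → K) 2)}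
          add_mem' := by
            rintro v v' ⟨h0, h4⟩ ⟨h0', h4'⟩
            refine ⟨?_, ?_⟩
            · simp only [Submodule.coe_add, Pi.add_apply, h0, h0', xf, hwadd, conj_add]
              ring
            · simp only [Submodule.coe_add, Pi.add_apply, h4, h4', hwadd]
          zero_mem' := by simp [xf, wf, conj_zero]
          smul_mem' := by
            rintro t v ⟨h0, h4⟩
            refine ⟨?_, ?_⟩
            · simp only [Submodule.coe_smul, Pi.smul_apply, h0, xf, hwsmul]
              simp only [Algebra.smul_def, conj_algebraMap_mul]
              ring
            · simp only [Submodule.coe_smul, Pi.smul_apply, h4, hwsmul] }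
      refine ⟨L, ?_, ?_, ?_, ?_⟩
      · refine finrank_of_coord hdeg 2 (fun v hv h => ?_) fun y => ⟨vhatMk F (xf y) y (wf y),
          ⟨rfl, rfl⟩, rfl⟩
        obtain ⟨h0, h4⟩ := hv
        rw [h] at h0 h4
        refine Vhat_ext ?_ h ?_
        · rw [h0]; simp [xf, wf, conj_zero]
        · rw [h4]; simp [wf, conj_zero]
      · rintro v ⟨h0, h4⟩
        refine (mem_sup_first hdeg hμ ha).2 ?_
        rw [h4, hwf]
      · rintro v ⟨h0, h4⟩
        refine (mem_sup_last hdeg hμ ha).2 ?_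
        -- With `ā = a` the second span equation is the conjugate of `φ(X) = w(Y)`.
        rw [h0, ← hwf, ← hxf ((v : Fin 6 → K) 2)]
        simp only [conj_add, conj_mul, conj_sub, conj_conj hdeg, haF]
        ring
      · rintro v ⟨h0, h4⟩
        refine (mem_sup_generic hdeg hμ ha).2 ?_
        rw [h0, h4, hxf]

end Coordinates

/-! ### Orthogonal pairs, and reduction to the normal form -/

section Final

variable {F K : Type*} [Field F] [Fintype F] [Field K] [Algebra F K]

theorem cosetOf_eq_shultE_iff {z : K} : cosetOf F z = shultE F K ↔ z ≠ 0 ∧ conj F z = z := by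
  constructor
  · intro h
    have h1 : (1 : K) ∈ shultE F K := ⟨1, one_ne_zero, by simp⟩
    have hz : z ∈ cosetOf F z := ⟨1, one_ne_zero, by simp⟩
    rw [← h] at h1
    rw [h] at hz
    obtain ⟨c, -, hc⟩ := h1
    obtain ⟨d, -, rfl⟩ := hz
    refine ⟨fun h0 => ?_, by rw [one_mul, conj_algebraMap]⟩
    rw [h0, zero_mul] at hc
    exact one_ne_zero hc
  · rintro ⟨h0, hz⟩
    obtain ⟨d, rfl⟩ := exists_algebraMap_eq hz
    have hd : d ≠ 0 := fun h => h0 (by rw [h, map_zero])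
    ext x
    constructor
    · rintro ⟨c, hc, rfl⟩
      exact ⟨d * c, mul_ne_zero hd hc, by rw [map_mul, one_mul]⟩
    · rintro ⟨c, hc, rfl⟩
      refine ⟨d⁻¹ * c, mul_ne_zero (inv_ne_zero hd) hc, ?_⟩
      rw [← map_mul, mul_inv_cancel_left₀ hd, one_mul]

theorem frameMap_first (f : Fin 4 → Fin 4 → K) : frameMap f ![1, 0, 0, 0] = f 0 := by
  simp [frameMap_eq]

theorem frameMap_last (f : Fin 4 → Fin 4 → K) : frameMap f ![0, 0, 0, 1] = f 3 := by
  simp [frameMap_eq]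

/-- Starting from any `u` with `h(u, p) = 1`, subtracting half of `h(u, u)` times `p` makes it
isotropic; this needs odd `q`. -/
theorem exists_hyperbolic_partner (hodd : Odd (Fintype.card F))
    (hdeg : Module.finrank F K = 2) {p : Fin 4 → K} (hp0 : p ≠ 0) (hp : herm F p p = 0) :
    ∃ q, herm F q q = 0 ∧ herm F p q = 1 := by
  have h2 : (2 : K) ≠ 0 := two_ne_zero_of_odd hodd
  obtain ⟨u, hu⟩ := exists_herm_eq_one (F := F) hp0
  have hu' : herm F p u = 1 := by rw [← conj_herm hdeg, hu, conj_one]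
  refine ⟨u - (herm F u u / 2) • p, ?_, ?_⟩
  · have hc : conj F (herm F u u / 2) = herm F u u / 2 := by
      have h2c : conj F (2 : K) = 2 := by
        rw [← one_add_one_eq_two, conj_add, conj_one]
      rw [conj_div, conj_herm hdeg, h2c]
    simp only [herm_sub_left, herm_sub_right, herm_smul_left, herm_smul_right, hu, hu', hp, hc]
    field_simp
    ring
  · rw [herm_sub_right, herm_smul_right, hp, hu', mul_zero, sub_zero]

/-- Hilbert 90: every `t + k̄ t̄` is a solution. If all of them vanished, `t = 1` would give `k̄ =
-1` and then conjugation would be trivial. -/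
theorem exists_conj_eq_mul (hdeg : Module.finrank F K = 2) {k : K} (hk : k * conj F k = 1) :
    ∃ s : K, s ≠ 0 ∧ conj F s = k * s := by
  have key : ∀ t : K, conj F (t + conj F k * conj F t) = k * (t + conj F k * conj F t) := by
    intro t
    rw [conj_add, conj_mul, conj_conj hdeg, conj_conj hdeg]
    linear_combination -conj F t * hk
  by_contra! hcon
  have hz : ∀ t : K, t + conj F k * conj F t = 0 := fun t => by
    by_contra h
    exact hcon _ h (key t)
  obtain ⟨t, ht⟩ := exists_conj_ne (F := F) (K := K) hdeg
  have e1 := hz 1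
  rw [conj_one] at e1
  exact ht (by linear_combination conj F t * e1 - hz t)

/-- The line `⟨p, q⟩` is totally isotropic and lies on both points, so its image is a common point.
In a frame with `p = e₀`, a multiple of its Plücker vector lying in `V̂` has to be exhibited. -/
theorem not_disjoint_lineOf (hodd : Odd (Fintype.card F)) (hdeg : Module.finrank F K = 2)
    {μ : K} (hμ : μ * conj F μ = -1) {p q : Fin 4 → K} (hp0 : p ≠ 0) (hp : herm F p p = 0)
    (hq : herm F q q = 0) (hpq : herm F p q = 0) (hqp : q ∉ Submodule.span K {p}) :
    ¬ Disjoint (lineOf F μ p) (lineOf F μ q) := by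
  obtain ⟨q', hq', hpq'⟩ := exists_hyperbolic_partner hodd hdeg hp0 hp
  obtain ⟨f, hf, rfl, rfl⟩ := exists_isFrame hodd hdeg hp hq' hpq'
  obtain ⟨e, he⟩ := exists_vhatEquiv hdeg hμ hf
  obtain ⟨x, rfl⟩ := hf.surjective q
  rw [← frameMap_first f, ← map_lineOf hμ hf he, ← map_lineOf hμ hf he]
  rw [← frameMap_first f, hf.herm_map] at hpq
  rw [hf.herm_map] at hq
  have hx3 : x 3 = 0 := by
    simpa [herm, conj_eq_zero] using hpq
  have hx : x 1 * conj F (x 1) + x 2 * conj F (x 2) = 0 := by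
    simp only [herm, hx3, conj_zero] at hq
    linear_combination -hq
  have hx1 : x 1 ≠ 0 := by
    intro h1
    have h2 : x 2 = 0 := by
      rw [h1, zero_mul, zero_add] at hx
      rcases mul_eq_zero.1 hx with h | h
      · exact h
      · exact conj_eq_zero.1 h
    refine hqp (Submodule.mem_span_singleton.2 ⟨x 0, ?_⟩)
    simp [frameMap_eq, h1, h2, hx3]
  have hx1c : conj F (x 1) ≠ 0 := conj_eq_zero.not.2 hx1
  -- The multiple `(s x₁, -μ̄ s x₂, 0, 0, 0, 0)` lies in `V̂` exactly when `s̄ = k s` for this `k`,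
  -- which has norm one because `x₁x̄₁ + x₂x̄₂ = 0`.
  obtain ⟨s, hs0, hs⟩ := exists_conj_eq_mul hdeg (k := -(conj F μ) * x 2 / conj F (x 1)) (by
    rw [conj_div, conj_mul, conj_neg, conj_conj hdeg, conj_conj hdeg]
    rw [div_mul_div_comm, div_eq_one_iff_eq (mul_ne_zero hx1c hx1)]
    linear_combination x 2 * conj F (x 2) * hμ - hx)
  intro hdis
  have hv : vhatMk F (s * x 1) 0 0 ∈ lineOf F μ x := by
    refine ⟨![-s, 0, 0, 0], ?_, ?_⟩
    · simp [herm, hx3, conj_zero]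
    · ext i
      fin_cases i <;> simp [vhatMk, tauPluecker_eq, hx3, conj_zero, conj_mul]
      · ring
      · rw [hs]
        field_simp
  have h0 := (Submodule.disjoint_def.1 hdis) (e (vhatMk F (s * x 1) 0 0))
    ⟨_, (mem_lineOf_first hμ).2 ⟨rfl, rfl⟩, rfl⟩ ⟨_, hv, rfl⟩
  have h1 := congrArg (fun v : Vhat F K => (v : Fin 6 → K) 0)
    ((LinearEquiv.map_eq_zero_iff e).1 h0)
  exact mul_ne_zero hs0 hx1 h1

/-- For pairwise non-orthogonal, non-collinear singular vectors `p`, `q`, `r` with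
`h(p, q) = h(r, q) = 1`, the lines are in perspective if and only if `h(r, p)` lies in the
subfield. -/
theorem inPerspective_lineOf_iff (hodd : Odd (Fintype.card F)) (hdeg : Module.finrank F K = 2)
    {μ : K} (hμ : μ * conj F μ = -1) {p q r : Fin 4 → K} (hp : herm F p p = 0)
    (hq : herm F q q = 0) (hr : herm F r r = 0) (hpq : herm F p q = 1) (hrq : herm F r q = 1)
    (hrp : herm F r p ≠ 0) (hspan : r ∉ Submodule.span K {p, q}) :
    InPerspective (lineOf F μ p) (lineOf F μ q) (lineOf F μ r) ↔
      conj F (herm F r p) = herm F r p := by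
  obtain ⟨f, hf, rfl, rfl⟩ := exists_isFrame hodd hdeg hp hq hpq
  obtain ⟨e, he⟩ := exists_vhatEquiv hdeg hμ hf
  obtain ⟨x, rfl⟩ := hf.surjective r
  rw [hf.herm_map] at hr
  rw [← frameMap_last f, hf.herm_map] at hrq
  rw [← frameMap_first f, hf.herm_map] at hrp ⊢
  have hx0 : x 0 = 1 := by simpa [herm, conj_zero, conj_one] using hrq
  have hx3 : herm F x ![1, 0, 0, 0] = x 3 := by simp [herm, conj_zero, conj_one]
  have hx : x = ![1, x 1, x 2, x 3] := by
    ext i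
    fin_cases i <;> simp [hx0]
  rw [hx3] at hrp ⊢
  rw [← frameMap_last f, ← map_lineOf hμ hf he, ← map_lineOf hμ hf he, ← map_lineOf hμ hf he,
    inPerspective_map_iff (map_perp hμ hf he)]
  have hiff := inPerspective_normalForm_iff (a := x 3) (b := x 1) (c := x 2) hdeg hμ ?_ hrp ?_
  · rwa [← hx] at hiff
  · simp only [herm, hx0, conj_one] at hr
    linear_combination hr
  -- If `b = c = 0`, then `r` is a combination of `p` and `q`.
  · rintro ⟨h1, h2⟩
    refine hspan (Submodule.mem_span_pair.2 ⟨x 0, x 3, ?_⟩)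
    simp [frameMap_eq, h1, h2]

theorem rep_notMem_span {P Q : Projectivization K (Fin 4 → K)} (h : P ≠ Q) :
    Q.rep ∉ Submodule.span K {P.rep} := by
  intro hmem
  obtain ⟨c, hc⟩ := Submodule.mem_span_singleton.1 hmem
  apply h
  rw [← P.mk_rep, ← Q.mk_rep, eq_comm, Projectivization.mk_eq_mk_iff']
  exact ⟨c, hc⟩

theorem herm_rep_ne_zero (hodd : Odd (Fintype.card F)) (hdeg : Module.finrank F K = 2)
    {μ : K} (hμ : μ * conj F μ = -1) {P Q : Projectivization K (Fin 4 → K)}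
    (hP : IsHermitianPoint F P) (hQ : IsHermitianPoint F Q) (hPQ : P ≠ Q)
    (hdis : Disjoint (lineOf F μ P.rep) (lineOf F μ Q.rep)) : herm F P.rep Q.rep ≠ 0 :=
  fun h => not_disjoint_lineOf hodd hdeg hμ P.rep_nonzero hP hQ h (rep_notMem_span hPQ) hdis

end Final

end HermitianKlein

open HermitianKlein in
theorem proposition4p1 {F K : Type*} [Field F] [Fintype F] [Field K] [Algebra F K]
    (hodd : Odd (Fintype.card F)) (hdeg : Module.finrank F K = 2)
    (μ : K) (hμ : μ ^ (Fintype.card F + 1) = -1)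
    (P Q R : Projectivization K (Fin 4 → K))
    (hP : HermitianKlein.IsHermitianPoint F P)
    (hQ : HermitianKlein.IsHermitianPoint F Q)
    (hR : HermitianKlein.IsHermitianPoint F R)
    (hPQ : P ≠ Q) (hQR : Q ≠ R) (hRP : R ≠ P)
    (hline : ¬ ∃ r : Submodule K (Fin 4 → K), HermitianKlein.IsHyperbolicLine F r ∧
      P.submodule ≤ r ∧ Q.submodule ≤ r ∧ R.submodule ≤ r) :
    HermitianKlein.shultZ F P Q R = HermitianKlein.shultE F K ↔
      HermitianKlein.InPerspective (HermitianKlein.rhoPoint F μ P)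
        (HermitianKlein.rhoPoint F μ Q) (HermitianKlein.rhoPoint F μ R) := by
  have hμ' : μ * conj F μ = -1 := by rw [← hμ, conj, pow_succ']
  rw [rhoPoint_eq hdeg hμ' P hP, rhoPoint_eq hdeg hμ' Q hQ, rhoPoint_eq hdeg hμ' R hR,
    shultZ, cosetOf_eq_shultE_iff]
  by_cases hne : herm F P.rep Q.rep ≠ 0 ∧ herm F Q.rep R.rep ≠ 0 ∧ herm F R.rep P.rep ≠ 0
  · obtain ⟨h1, h2, h3⟩ := hne
    have hPs : P.submodule = Submodule.span K {P.rep} := P.submodule_eq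
    have hQs : Q.submodule = Submodule.span K {Q.rep} := Q.submodule_eq
    have hRs : R.submodule = Submodule.span K {R.rep} := R.submodule_eq
    have hp : herm F P.rep P.rep = 0 := hP
    have hq : herm F Q.rep Q.rep = 0 := hQ
    have hr : herm F R.rep R.rep = 0 := hR
    generalize P.rep = p at *
    generalize Q.rep = q at *
    generalize R.rep = r at *
    -- `q` is replaced by `tq` and `r` by `sr` so that `h(p, tq) = h(sr, tq) = 1`.
    obtain ⟨t, ht⟩ : ∃ t : K, conj F t * herm F p q = 1 := by
      refine ⟨conj F (herm F p q)⁻¹, ?_⟩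
      rw [conj_conj hdeg, inv_mul_cancel₀ h1]
    have htc : t * herm F q p = 1 := by
      have := congrArg (conj F) ht
      rwa [conj_mul, conj_conj hdeg, conj_herm hdeg, conj_one] at this
    have h2' : herm F r q ≠ 0 := fun h => h2 (herm_comm_zero hdeg h)
    have ht0 : t ≠ 0 := left_ne_zero_of_mul_eq_one htc
    have htc0 : conj F t ≠ 0 := conj_eq_zero.not.2 ht0
    obtain ⟨s, hs⟩ : ∃ s : K, s * (conj F t * herm F r q) = 1 :=
      ⟨_, inv_mul_cancel₀ (mul_ne_zero htc0 h2')⟩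
    have hsc : conj F s * (t * herm F q r) = 1 := by
      have := congrArg (conj F) hs
      rwa [conj_mul, conj_mul, conj_conj hdeg, conj_herm hdeg, conj_one] at this
    have hs0 : s ≠ 0 := left_ne_zero_of_mul_eq_one hs
    have hsc0 : conj F s ≠ 0 := conj_eq_zero.not.2 hs0
    have hiff := inPerspective_lineOf_iff (p := p) (q := t • q) (r := s • r) hodd hdeg hμ' hp
      (by simp [herm_smul_left, herm_smul_right, hq])
      (by simp [herm_smul_left, herm_smul_right, hr])
      (by rw [herm_smul_right, ht])
      (by rw [herm_smul_left, herm_smul_right, hs])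
      (by rw [herm_smul_left]; exact mul_ne_zero hs0 h3)
      (fun hmem => hline ⟨Submodule.span K {p, t • q}, ⟨p, t • q, hp,
        by simp [herm_smul_left, herm_smul_right, hq], by rw [herm_smul_right, ht], rfl⟩, by
          rw [hPs]
          exact Submodule.span_mono (by simp), by
          rw [hQs, Submodule.span_singleton_le_iff_mem]
          exact (Submodule.smul_mem_iff _ ht0).1 (Submodule.subset_span (by simp)), by
          rw [hRs, Submodule.span_singleton_le_iff_mem]
          exact (Submodule.smul_mem_iff _ hs0).1 hmem⟩)
    rw [lineOf_smul μ ht0, lineOf_smul μ hs0, herm_smul_left] at hiff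
    rw [hiff]
    set z := herm F p q * herm F q r * herm F r p with hz
    have hz0 : z ≠ 0 := mul_ne_zero (mul_ne_zero h1 h2) h3
    have hn0 : t * conj F t * (s * conj F s) ≠ 0 :=
      mul_ne_zero (mul_ne_zero ht0 htc0) (mul_ne_zero hs0 hsc0)
    -- The normalized invariant `h(sr, p)` differs from `z` by norms, which are nonzero elements of
    -- the subfield.
    have hnz : s * herm F r p = t * conj F t * (s * conj F s) * z := by
      rw [hz]
      linear_combination -(s * herm F r p) * ht
        - (s * herm F r p) * (conj F t * herm F p q) * hsc
    have hnc : conj F (t * conj F t * (s * conj F s)) = t * conj F t * (s * conj F s) := by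
      simp only [conj_mul, conj_conj hdeg]
      ring
    rw [hnz, conj_mul F (t * conj F t * (s * conj F s)) z, hnc, mul_right_inj' hn0]
    exact and_iff_right hz0
  -- Some pair is orthogonal: the product is zero and two of the lines are not skew, so both sides
  -- are false.
  · constructor
    · rintro ⟨h, -⟩
      exact absurd ⟨left_ne_zero_of_mul (left_ne_zero_of_mul h),
        right_ne_zero_of_mul (left_ne_zero_of_mul h), right_ne_zero_of_mul h⟩ hne
    · intro h
      exact absurd ⟨herm_rep_ne_zero hodd hdeg hμ' hP hQ hPQ (h.line_skew 0 1 (by decide)),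
        herm_rep_ne_zero hodd hdeg hμ' hQ hR hQR (h.line_skew 1 2 (by decide)),
        herm_rep_ne_zero hodd hdeg hμ' hR hP hRP (h.line_skew 2 0 (by decide))⟩ hne
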